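/- **Theorem 1.1.** There is an absolute constant $c>0$ such that for every finite field $\mathbb{F}$ and all integers $n,m,R,r$ with $\min\{n,m\}\ge R>r\ge 0$, $$Q^*_{\frac12-\frac{1}{4|\mathbb{F}|^{r/3}}}\bigl(\mathrm{RANK}^{\mathbb{F},n,m}_{r,R}\bigr)\;\ge\; c\,(1+r^2\log_2|\mathbb{F}|),$$ and in particular $$Q^*_{1/4}\bigl(\mathrm{RANK}^{\mathbb{F},n,m}_{r,R}\bigr)\;\ge\; c\,(1+r^2\log_2|\mathbb{F}|).$$ Here $\mathrm{RANK}^{\mathbb{F},n,m}_{r,R}$ is the two-party promise problem in which Alice receives $A\in\mathbb{F}^{n\times m}$, Bob receives $B\in\mathbb{F}^{n\times m}$, and the correct output is $-1$ if $\operatorname{rk}(A+B)=r$ and $1$ if $\operatorname{rk}(A+B)=R$; for all other input pairs the output is unconstrained. For a partial function $f\colon X\times Y\to\{-1,1,*\}$, $Q^*_\epsilon(f)$ denotes the $\epsilon$-error quantum communication complexity with arbitrary prior entanglement: the least number of qubits exchanged in a two-party quantum protocol in which the parties start from an arbitrary input-independent (finite-dimensional) shared entangled state, exchange qubits, finally measure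 to obtain an output in $\{-1,1\}$, and, for every $(x,y)$ with $f(x,y)\neq *$, output $f(x,y)$ with probability at least $1-\epsilon$. -/

import Mathlib

universe u v

section QuantumCommunication

open scoped Matrix Kronecker ComplexOrder

/-- Two-party quantum protocols with input sets `X` (Alice) and `Y` (Bob), at a moment when Alice's
register is `ℂ^a` and Bob's register is `ℂ^b`. The joint state is a vector of `ℂ^a ⊗ ℂ^b`, given by
its coordinates `Fin a × Fin b → ℂ`.

* In `aliceSend`, Alice applies to her register an isometry depending on her input (a unitary
  operation, possibly with fresh ancillas), splits the result `ℂ^a' ⊗ ℂ^2` into a register that she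
  keeps and one qubit, and hands that qubit to Bob, who adds it to his register. `bobSend` is the
  same with the roles exchanged. The parties may speak in any order, and a message of `k` qubits is
  a sequence of `k` one-qubit messages.
* At the end, one of the parties performs on its own register a two-outcome measurement (a POVM)
  depending on its own input; its outcome in `{-1, 1}` is the output of the protocol. -/
inductive QuantumProtocol (X : Type u) (Y : Type v) : ℕ → ℕ → Type (max u v)
  | aliceSend {a b : ℕ} (a' : ℕ) (U : X → Matrix (Fin a' × Fin 2) (Fin a) ℂ)
      (isometry : ∀ x, (U x)ᴴ * U x = 1)
      (next : QuantumProtocol X Y a' (2 * b)) : QuantumProtocol X Y a b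
  | bobSend {a b : ℕ} (b' : ℕ) (V : Y → Matrix (Fin 2 × Fin b') (Fin b) ℂ)
      (isometry : ∀ y, (V y)ᴴ * V y = 1)
      (next : QuantumProtocol X Y (a * 2) b') : QuantumProtocol X Y a b
  | aliceOutput {a b : ℕ} (M : X → ℤˣ → Matrix (Fin a) (Fin a) ℂ)
      (posSemidef : ∀ x o, (M x o).PosSemidef) (sum_eq_one : ∀ x, M x 1 + M x (-1) = 1) :
      QuantumProtocol X Y a b
  | bobOutput {a b : ℕ} (M : Y → ℤˣ → Matrix (Fin b) (Fin b) ℂ)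
      (posSemidef : ∀ y o, (M y o).PosSemidef) (sum_eq_one : ∀ y, M y 1 + M y (-1) = 1) :
      QuantumProtocol X Y a b

namespace QuantumProtocol

variable {X : Type u} {Y : Type v}

/-- The number of qubits exchanged. -/
def cost : {a b : ℕ} → QuantumProtocol X Y a b → ℕ
  | _, _, aliceSend _ _ _ P => P.cost + 1
  | _, _, bobSend _ _ _ P => P.cost + 1
  | _, _, aliceOutput _ _ _ => 0
  | _, _, bobOutput _ _ _ => 0

/-- Hand a qubit over from Alice to Bob: `(ℂ^a ⊗ ℂ^2) ⊗ ℂ^b = ℂ^a ⊗ (ℂ^2 ⊗ ℂ^b)`. -/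
def passToBob {a b : ℕ} (φ : (Fin a × Fin 2) × Fin b → ℂ) : Fin a × Fin (2 * b) → ℂ :=
  fun p => φ ((p.1, (finProdFinEquiv.symm p.2).1), (finProdFinEquiv.symm p.2).2)

/-- Hand a qubit over from Bob to Alice: `ℂ^a ⊗ (ℂ^2 ⊗ ℂ^b) = (ℂ^a ⊗ ℂ^2) ⊗ ℂ^b`. -/
def passToAlice {a b : ℕ} (φ : Fin a × (Fin 2 × Fin b) → ℂ) : Fin (a * 2) × Fin b → ℂ :=
  fun p => φ ((finProdFinEquiv.symm p.1).1, ((finProdFinEquiv.symm p.1).2, p.2))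

/-- The probability that the protocol, run on the input pair `(x, y)` from the joint state `ψ`,
outputs `o ∈ {-1, 1}`. -/
noncomputable def outputProb (x : X) (y : Y) (o : ℤˣ) :
    {a b : ℕ} → QuantumProtocol X Y a b → (Fin a × Fin b → ℂ) → ℝ
  | _, b, aliceSend _ U _ P, ψ =>
      outputProb x y o P (passToBob ((U x ⊗ₖ (1 : Matrix (Fin b) (Fin b) ℂ)) *ᵥ ψ))
  | a, _, bobSend _ V _ P, ψ =>
      outputProb x y o P (passToAlice (((1 : Matrix (Fin a) (Fin a) ℂ) ⊗ₖ V y) *ᵥ ψ))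
  | _, b, aliceOutput M _ _, ψ =>
      (star ψ ⬝ᵥ ((M x o ⊗ₖ (1 : Matrix (Fin b) (Fin b) ℂ)) *ᵥ ψ)).re
  | a, _, bobOutput M _ _, ψ =>
      (star ψ ⬝ᵥ (((1 : Matrix (Fin a) (Fin a) ℂ) ⊗ₖ M y o) *ᵥ ψ)).re

end QuantumProtocol

/-- A quantum protocol with prior entanglement: the parties start from an arbitrary
(input-independent) unit vector of `ℂ^a ⊗ ℂ^b`, for arbitrary finite dimensions `a` and `b`. -/
structure EntangledProtocol (X : Type u) (Y : Type v) where
  aliceDim : ℕ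
  bobDim : ℕ
  state : Fin aliceDim × Fin bobDim → ℂ
  state_unit : star state ⬝ᵥ state = 1
  protocol : QuantumProtocol X Y aliceDim bobDim

namespace EntangledProtocol

variable {X : Type u} {Y : Type v}

/-- The number of qubits exchanged. -/
def cost (P : EntangledProtocol X Y) : ℕ := P.protocol.cost

/-- The probability that the protocol outputs `o ∈ {-1, 1}` on the input pair `(x, y)`. -/
noncomputable def outputProb (P : EntangledProtocol X Y) (x : X) (y : Y) (o : ℤˣ) : ℝ :=
  P.protocol.outputProb x y o P.state

/-- `P` is an `ε`-error protocol for the partial function `f : X × Y → {-1, 1, *}`, where `none`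
stands for `*`: it gives the correct answer with probability at least `1 - ε` on every input pair
of the domain of `f`; its behaviour on the other input pairs is arbitrary. -/
def Computes (P : EntangledProtocol X Y) (ε : ℝ) (f : X → Y → Option ℤˣ) : Prop :=
  ∀ x y o, f x y = some o → 1 - ε ≤ P.outputProb x y o

end EntangledProtocol

/-- The `ε`-error quantum communication complexity with prior entanglement of a (possibly partial)
communication problem: the least cost of an `ε`-error protocol. -/
noncomputable def quantumCC {X : Type u} {Y : Type v} (ε : ℝ) (f : X → Y → Option ℤˣ) : ℕ∞ :=
  ⨅ (P : EntangledProtocol X Y) (_ : P.Computes ε f), (P.cost : ℕ∞)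

/-- The promise problem of distinguishing `rk (A + B) = r` (value `-1`) from `rk (A + B) = R`
(value `1`), for matrices `A, B ∈ F^{n × m}`. -/
noncomputable def rankProblem (F : Type u) [Field F] (n m r R : ℕ)
    (A B : Matrix (Fin n) (Fin m) F) : Option ℤˣ :=
  if (A + B).rank = r then some (-1) else if (A + B).rank = R then some 1 else none

end QuantumCommunication

/-! The lower bound pairs a spectral upper bound on correlations with a signed witness supported on
few ranks.

Upper bound. Resolving each exchanged qubit in the bra and in the ket writes the output probability
of a protocol of cost `C` as a sum of `4 ^ C` product observables in the shared state
(`exists_product_observables`). Each of these is, as a function of the inputs, an inner product of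
vectors of norm at most one that depend on one input each. Hence its correlation with an `N × N`
matrix of operator norm `K` is at most `K * N`, so the protocol's is at most `4 ^ C * K * N`. For a
matrix `φ (A + B)` one may take `K` to be the largest Fourier coefficient of `φ`
(`norm_sum_add_mul_le`).

Witness. Let `φ = ∑ c t • (law of a random matrix of rank t)`, with `q = |F|`. At a frequency of
rank `s` the Fourier coefficient of the rank `t` law is a polynomial of degree at most `s` in `q⁻ᵗ`,
and it is at most `4 q ^ (-ts/2)`. Weights on `d + 2` ranks that annihilate polynomials of degree
`d` kill all frequencies of rank at most `d` (`sum_mul_rankAverage_addChar_eq_zero`). With `d` about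
`r / 40` and all ranks used at least `r / 2`, the surviving coefficients are `q ^ (-Ω(r²))`.

Because the nodes `q⁻ᵗ` decrease geometrically, the weights away from `r` and `R` are tiny
(`exists_annihilating_weights`). A correct protocol therefore correlates with `φ` in proportion to
its advantage `γ` (`advantage_le_of_computes_rankProblem`), even for `γ` of order `q ^ (-r/3)`, and
comparing the two bounds forces `4 ^ C ≥ q ^ (Ω(r²))`. -/

section QuantumDecomposition

open scoped Matrix Kronecker ComplexOrder Matrix.Norms.L2Operator

/-! ### Contractions acting on tensor products -/

namespace Matrix

theorem l2_opNorm_one_le {n : Type*} [Fintype n] [DecidableEq n] : ‖(1 : Matrix n n ℂ)‖ ≤ 1 := by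
  rw [← diagonal_one, l2_opNorm_diagonal]
  exact (pi_norm_le_iff_of_nonneg zero_le_one).2 fun i => by simp

theorem l2_opNorm_le_one_of_isometry {m n : Type*} [Fintype m] [Fintype n] [DecidableEq m]
    [DecidableEq n] {U : Matrix m n ℂ} (h : Uᴴ * U = 1) : ‖U‖ ≤ 1 := by
  have h1 := l2_opNorm_conjTranspose_mul_self U
  rw [h] at h1
  have h2 : ‖(1 : Matrix n n ℂ)‖ ≤ 1 := l2_opNorm_one_le
  nlinarith [norm_nonneg U]

theorem l2_opNorm_one_submatrix_le {m n : Type*} [Fintype m] [Fintype n] [DecidableEq m]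
    [DecidableEq n] {f : m → n} (hf : f.Injective) :
    ‖(1 : Matrix n n ℂ).submatrix f id‖ ≤ 1 := by
  rw [← l2_opNorm_conjTranspose]
  refine l2_opNorm_le_one_of_isometry ?_
  rw [conjTranspose_conjTranspose, conjTranspose_submatrix, conjTranspose_one,
    ← submatrix_mul _ _ f id f Function.bijective_id, Matrix.one_mul, submatrix_one _ hf]

theorem l2_opNorm_mul_le_one {l m n : Type*} [Fintype l] [Fintype m] [Fintype n] [DecidableEq l]
    [DecidableEq m] [DecidableEq n] {A : Matrix l m ℂ} {B : Matrix m n ℂ} (hA : ‖A‖ ≤ 1)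
    (hB : ‖B‖ ≤ 1) : ‖A * B‖ ≤ 1 :=
  (l2_opNorm_mul A B).trans (mul_le_one₀ hA (norm_nonneg _) hB)

theorem l2_opNorm_rows_le_one {l m n : Type*} [Fintype l] [Fintype m] [Fintype n] [DecidableEq l]
    [DecidableEq m] [DecidableEq n] {U : Matrix m n ℂ} (hU : ‖U‖ ≤ 1) {f : l → m}
    (hf : f.Injective) : ‖U.submatrix f id‖ ≤ 1 := by
  have h : U.submatrix f id = (1 : Matrix m m ℂ).submatrix f id * U := by
    ext i j
    simp [mul_apply, one_apply]
  rw [h]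
  exact l2_opNorm_mul_le_one (l2_opNorm_one_submatrix_le hf) hU

open scoped MatrixOrder in
theorem PosSemidef.l2_opNorm_le_one {n : Type*} [Fintype n] [DecidableEq n] {A : Matrix n n ℂ}
    (hA : A.PosSemidef) (hA1 : (1 - A).PosSemidef) : ‖A‖ ≤ 1 :=
  letI : CStarAlgebra (Matrix n n ℂ) := { }
  (CStarAlgebra.norm_le_one_iff_of_nonneg A hA.nonneg).2 (Matrix.le_iff.2 hA1)

theorem sum_norm_sq_mulVec_le {m n : Type*} [Fintype m] [Fintype n] [DecidableEq m]
    [DecidableEq n] {A : Matrix m n ℂ} (hA : ‖A‖ ≤ 1) (v : n → ℂ) :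
    ∑ i, ‖(A *ᵥ v) i‖ ^ 2 ≤ ∑ j, ‖v j‖ ^ 2 := by
  have h := l2_opNorm_mulVec A (WithLp.toLp 2 v)
  have h' := h.trans (mul_le_of_le_one_left (norm_nonneg _) hA)
  have h2 := pow_le_pow_left₀ (norm_nonneg _) h' 2
  rw [EuclideanSpace.norm_sq_eq, EuclideanSpace.norm_sq_eq] at h2
  simpa using h2

theorem sum_norm_sq_kronecker_one_mulVec_le {m n : Type*} [Fintype m] [Fintype n] [DecidableEq m]
    [DecidableEq n] {A : Matrix m m ℂ} (hA : ‖A‖ ≤ 1) (ψ : m × n → ℂ) :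
    ∑ p, ‖((A ⊗ₖ (1 : Matrix n n ℂ)) *ᵥ ψ) p‖ ^ 2 ≤ ∑ p, ‖ψ p‖ ^ 2 := by
  have h : ∀ p, ((A ⊗ₖ (1 : Matrix n n ℂ)) *ᵥ ψ) p = (A *ᵥ fun i => ψ (i, p.2)) p.1 := by
    intro p
    simp [mulVec, dotProduct, Fintype.sum_prod_type, kroneckerMap_apply, one_apply, ite_mul]
  simp_rw [h]
  rw [Fintype.sum_prod_type_right, Fintype.sum_prod_type_right]
  exact Finset.sum_le_sum fun j _ => sum_norm_sq_mulVec_le hA fun i => ψ (i, j)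

theorem sum_norm_sq_one_kronecker_mulVec_le {m n : Type*} [Fintype m] [Fintype n] [DecidableEq m]
    [DecidableEq n] {B : Matrix n n ℂ} (hB : ‖B‖ ≤ 1) (ψ : m × n → ℂ) :
    ∑ p, ‖(((1 : Matrix m m ℂ) ⊗ₖ B) *ᵥ ψ) p‖ ^ 2 ≤ ∑ p, ‖ψ p‖ ^ 2 := by
  have h : ∀ p, (((1 : Matrix m m ℂ) ⊗ₖ B) *ᵥ ψ) p = (B *ᵥ fun j => ψ (p.1, j)) p.2 := by
    intro p
    simp [mulVec, dotProduct, Fintype.sum_prod_type_right, kroneckerMap_apply, one_apply, ite_mul]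
  simp_rw [h]
  rw [Fintype.sum_prod_type, Fintype.sum_prod_type]
  exact Finset.sum_le_sum fun i _ => sum_norm_sq_mulVec_le hB fun j => ψ (i, j)

theorem star_mulVec_dotProduct_mulVec {m n : Type*} [Fintype m] [Fintype n]
    (A B : Matrix m n ℂ) (C : Matrix m m ℂ) (ψ : n → ℂ) :
    star (A *ᵥ ψ) ⬝ᵥ (C *ᵥ (B *ᵥ ψ)) = star ψ ⬝ᵥ ((Aᴴ * C * B) *ᵥ ψ) := by
  rw [star_mulVec, ← dotProduct_mulVec, mulVec_mulVec, mulVec_mulVec, Matrix.mul_assoc]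

theorem star_mulVec_dotProduct_mulVec_of_isometry {m n : Type*} [Fintype m] [Fintype n]
    [DecidableEq n] {A : Matrix m n ℂ} (h : Aᴴ * A = 1) (ψ : n → ℂ) :
    star (A *ᵥ ψ) ⬝ᵥ (A *ᵥ ψ) = star ψ ⬝ᵥ ψ := by
  rw [star_mulVec, ← dotProduct_mulVec, mulVec_mulVec, h, one_mulVec]

/-- Expansion of a product observable in a state that is itself a sum of product operators. -/
theorem star_sum_kronecker_dotProduct {k a b a' b' : Type*} [Fintype k] [Fintype a] [Fintype b]
    [Fintype a'] [Fintype b'] (A : k → Matrix a' a ℂ) (B : k → Matrix b' b ℂ)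
    (E : Matrix a' a' ℂ) (G : Matrix b' b' ℂ) (ψ : a × b → ℂ) :
    star (∑ c, (A c ⊗ₖ B c) *ᵥ ψ) ⬝ᵥ ((E ⊗ₖ G) *ᵥ ∑ d, (A d ⊗ₖ B d) *ᵥ ψ) =
      ∑ cd : k × k, star ψ ⬝ᵥ
        ((((A cd.1)ᴴ * E * A cd.2) ⊗ₖ ((B cd.1)ᴴ * G * B cd.2)) *ᵥ ψ) := by
  rw [star_sum, sum_dotProduct, Fintype.sum_prod_type]
  refine Finset.sum_congr rfl fun c _ => ?_
  rw [mulVec_sum, dotProduct_sum]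
  refine Finset.sum_congr rfl fun d _ => ?_
  rw [star_mulVec_dotProduct_mulVec, conjTranspose_kronecker, ← mul_kronecker_mul,
    ← mul_kronecker_mul]

end Matrix

/-! ### Protocols as sums of product observables -/

namespace QuantumProtocol

open Matrix

variable {X : Type u} {Y : Type v}

/-- Resolve the message in its basis states `c`: Alice keeps the rows of `U` ending in `c`, and
Bob's register undergoes `v ↦ e_c ⊗ v`. -/
theorem passToBob_eq_sum {a' a b : ℕ} (U : Matrix (Fin a' × Fin 2) (Fin a) ℂ)
    (ψ : Fin a × Fin b → ℂ) :
    passToBob ((U ⊗ₖ (1 : Matrix (Fin b) (Fin b) ℂ)) *ᵥ ψ) =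
      ∑ c : Fin 2, (U.submatrix (fun i => (i, c)) id ⊗ₖ
        ((1 : Matrix (Fin (2 * b)) (Fin (2 * b)) ℂ).submatrix
          (fun j : Fin b => finProdFinEquiv (c, j)) id)ᴴ) *ᵥ ψ := by
  ext ⟨i, j⟩
  obtain ⟨⟨c, j⟩, rfl⟩ := finProdFinEquiv.surjective j
  simp [passToBob, mulVec, dotProduct, Fintype.sum_prod_type, kroneckerMap_apply, one_apply,
    Finset.sum_apply, ite_and]

theorem passToAlice_eq_sum {b' a b : ℕ} (V : Matrix (Fin 2 × Fin b') (Fin b) ℂ)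
    (ψ : Fin a × Fin b → ℂ) :
    passToAlice (((1 : Matrix (Fin a) (Fin a) ℂ) ⊗ₖ V) *ᵥ ψ) =
      ∑ c : Fin 2, (((1 : Matrix (Fin (a * 2)) (Fin (a * 2)) ℂ).submatrix
          (fun i : Fin a => finProdFinEquiv (i, c)) id)ᴴ ⊗ₖ
            V.submatrix (fun j => (c, j)) id) *ᵥ ψ := by
  ext ⟨i, j⟩
  obtain ⟨⟨i, c⟩, rfl⟩ := finProdFinEquiv.surjective i
  simp [passToAlice, mulVec, dotProduct, Fintype.sum_prod_type, kroneckerMap_apply, one_apply,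
    Finset.sum_apply, ite_and]

/-- The output probability of a protocol of cost `C` is a sum of `4 ^ C` product observables, all
of them contractions. -/
theorem exists_product_observables (o : ℤˣ) {a b : ℕ} (P : QuantumProtocol X Y a b) :
    ∃ (ι : Type) (_ : Fintype ι) (E : ι → X → Matrix (Fin a) (Fin a) ℂ)
      (G : ι → Y → Matrix (Fin b) (Fin b) ℂ), Fintype.card ι = 4 ^ P.cost ∧
      (∀ j x, ‖E j x‖ ≤ 1) ∧ (∀ j y, ‖G j y‖ ≤ 1) ∧
      ∀ x y ψ, outputProb x y o P ψ = (∑ j, star ψ ⬝ᵥ ((E j x ⊗ₖ G j y) *ᵥ ψ)).re := by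
  have povm : ∀ {n : ℕ} (M : ℤˣ → Matrix (Fin n) (Fin n) ℂ), (∀ o, (M o).PosSemidef) →
      M 1 + M (-1) = 1 → ‖M o‖ ≤ 1 := by
    intro n M hM h1
    refine (hM o).l2_opNorm_le_one ?_
    rcases Int.units_eq_one_or o with rfl | rfl
    · rw [← h1, add_sub_cancel_left]; exact hM _
    · rw [← h1, add_sub_cancel_right]; exact hM _
  induction P with
  | @aliceSend a b a' U hU P ih =>
    obtain ⟨ι, _, E, G, hι, hE, hG, hP⟩ := ih
    -- The extra index is the value of the qubit in the bra and in the ket, whence a factor 4 per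
    -- message.
    refine ⟨ι × (Fin 2 × Fin 2), inferInstance,
      fun j x => ((U x).submatrix (fun i => (i, j.2.1)) id)ᴴ * E j.1 x *
        (U x).submatrix (fun i => (i, j.2.2)) id,
      fun j y => ((1 : Matrix (Fin (2 * b)) (Fin (2 * b)) ℂ).submatrix
          (fun q : Fin b => finProdFinEquiv (j.2.1, q)) id)ᴴᴴ * G j.1 y *
        ((1 : Matrix (Fin (2 * b)) (Fin (2 * b)) ℂ).submatrix
          (fun q : Fin b => finProdFinEquiv (j.2.2, q)) id)ᴴ, ?_, ?_, ?_, ?_⟩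
    · simp [hι, cost, pow_succ]
    · intro j x
      have h := fun c : Fin 2 => l2_opNorm_rows_le_one (l2_opNorm_le_one_of_isometry (hU x))
        (Prod.mk_left_injective c : Function.Injective fun i : Fin a' => (i, c))
      refine l2_opNorm_mul_le_one (l2_opNorm_mul_le_one ?_ (hE _ _)) (h _)
      rw [l2_opNorm_conjTranspose]
      exact h _
    · intro j y
      have h := fun c : Fin 2 => l2_opNorm_one_submatrix_le
        (finProdFinEquiv.injective.comp
          (Prod.mk_right_injective c : Function.Injective fun q : Fin b => (c, q)))
      refine l2_opNorm_mul_le_one (l2_opNorm_mul_le_one ?_ (hG _ _)) ?_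
      · rw [conjTranspose_conjTranspose]
        exact h _
      · rw [l2_opNorm_conjTranspose]
        exact h _
    · intro x y ψ
      rw [outputProb, hP, passToBob_eq_sum, Fintype.sum_prod_type]
      congr 1
      exact Finset.sum_congr rfl fun j _ => star_sum_kronecker_dotProduct _ _ _ _ _
  | @bobSend a b b' V hV P ih =>
    obtain ⟨ι, _, E, G, hι, hE, hG, hP⟩ := ih
    refine ⟨ι × (Fin 2 × Fin 2), inferInstance,
      fun j x => ((1 : Matrix (Fin (a * 2)) (Fin (a * 2)) ℂ).submatrix
          (fun q : Fin a => finProdFinEquiv (q, j.2.1)) id)ᴴᴴ * E j.1 x *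
        ((1 : Matrix (Fin (a * 2)) (Fin (a * 2)) ℂ).submatrix
          (fun q : Fin a => finProdFinEquiv (q, j.2.2)) id)ᴴ,
      fun j y => ((V y).submatrix (fun i => (j.2.1, i)) id)ᴴ * G j.1 y *
        (V y).submatrix (fun i => (j.2.2, i)) id, ?_, ?_, ?_, ?_⟩
    · simp [hι, cost, pow_succ]
    · intro j y
      have h := fun c : Fin 2 => l2_opNorm_one_submatrix_le
        (finProdFinEquiv.injective.comp
          (Prod.mk_left_injective c : Function.Injective fun q : Fin a => (q, c)))
      refine l2_opNorm_mul_le_one (l2_opNorm_mul_le_one ?_ (hE _ _)) ?_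
      · rw [conjTranspose_conjTranspose]
        exact h _
      · rw [l2_opNorm_conjTranspose]
        exact h _
    · intro j x
      have h := fun c : Fin 2 => l2_opNorm_rows_le_one (l2_opNorm_le_one_of_isometry (hV x))
        (Prod.mk_right_injective c : Function.Injective fun i : Fin b' => (c, i))
      refine l2_opNorm_mul_le_one (l2_opNorm_mul_le_one ?_ (hG _ _)) (h _)
      rw [l2_opNorm_conjTranspose]
      exact h _
    · intro x y ψ
      rw [outputProb, hP, passToAlice_eq_sum, Fintype.sum_prod_type]
      congr 1
      exact Finset.sum_congr rfl fun j _ => star_sum_kronecker_dotProduct _ _ _ _ _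
  | aliceOutput M hM h1 =>
    refine ⟨Unit, inferInstance, fun _ x => M x o, fun _ _ => 1, by simp [cost],
      fun _ x => povm (M x) (hM x) (h1 x), fun _ _ => l2_opNorm_one_le, fun x y ψ => ?_⟩
    simp [outputProb]
  | bobOutput M hM h1 =>
    refine ⟨Unit, inferInstance, fun _ _ => 1, fun _ y => M y o, by simp [cost],
      fun _ _ => l2_opNorm_one_le, fun _ y => povm (M y) (hM y) (h1 y), fun x y ψ => ?_⟩
    simp [outputProb]

theorem outputProb_nonneg (x : X) (y : Y) (o : ℤˣ) {a b : ℕ} (P : QuantumProtocol X Y a b)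
    (ψ : Fin a × Fin b → ℂ) : 0 ≤ outputProb x y o P ψ := by
  induction P with
  | aliceSend a' U hU P ih => exact ih _
  | bobSend b' V hV P ih => exact ih _
  | aliceOutput M hM h1 => exact ((hM x o).kronecker PosSemidef.one).re_dotProduct_nonneg ψ
  | bobOutput M hM h1 => exact (PosSemidef.one.kronecker (hM y o)).re_dotProduct_nonneg ψ

theorem star_passToBob_dotProduct {a b : ℕ} (φ : (Fin a × Fin 2) × Fin b → ℂ) :
    star (passToBob φ) ⬝ᵥ passToBob φ = star φ ⬝ᵥ φ := by
  simp only [dotProduct, Fintype.sum_prod_type, Pi.star_apply, passToBob]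
  refine Finset.sum_congr rfl fun i _ => ?_
  rw [← finProdFinEquiv.sum_comp]
  simp [Fintype.sum_prod_type]

theorem star_passToAlice_dotProduct {a b : ℕ} (φ : Fin a × (Fin 2 × Fin b) → ℂ) :
    star (passToAlice φ) ⬝ᵥ passToAlice φ = star φ ⬝ᵥ φ := by
  simp only [dotProduct, Fintype.sum_prod_type, Pi.star_apply, passToAlice]
  rw [← finProdFinEquiv.sum_comp]
  simp [Fintype.sum_prod_type]

theorem outputProb_one_add_outputProb_neg_one (x : X) (y : Y) {a b : ℕ}
    (P : QuantumProtocol X Y a b) (ψ : Fin a × Fin b → ℂ) :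
    outputProb x y 1 P ψ + outputProb x y (-1) P ψ = (star ψ ⬝ᵥ ψ).re := by
  induction P with
  | aliceSend a' U hU P ih =>
    simp only [outputProb]
    rw [ih, star_passToBob_dotProduct, star_mulVec_dotProduct_mulVec_of_isometry]
    rw [conjTranspose_kronecker, ← mul_kronecker_mul, hU]
    simp
  | bobSend b' V hV P ih =>
    simp only [outputProb]
    rw [ih, star_passToAlice_dotProduct, star_mulVec_dotProduct_mulVec_of_isometry]
    rw [conjTranspose_kronecker, ← mul_kronecker_mul, hV]
    simp
  | aliceOutput M hM h1 =>
    simp only [outputProb]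
    rw [← Complex.add_re, ← dotProduct_add, ← add_mulVec, ← add_kronecker, h1]
    simp
  | bobOutput M hM h1 =>
    simp only [outputProb]
    rw [← Complex.add_re, ← dotProduct_add, ← add_mulVec, ← kronecker_add, h1]
    simp

end QuantumProtocol

theorem star_dotProduct_self_eq_sum_norm_sq {n : Type*} [Fintype n] (ψ : n → ℂ) :
    star ψ ⬝ᵥ ψ = ((∑ i, ‖ψ i‖ ^ 2 : ℝ) : ℂ) := by
  simp [dotProduct, Complex.conj_mul']

/-- A bilinear form of norm at most `K`, evaluated on the two families of vectors given by
contractions acting on the two registers of a unit vector. -/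
theorem norm_sum_mul_star_kronecker_le {X Y : Type*} [Fintype X] [Fintype Y] {Φ : X → Y → ℂ}
    {K : ℝ} (hK : 0 ≤ K)
    (hΦ : ∀ (f : X → ℂ) (g : Y → ℂ), ‖∑ x, ∑ y, Φ x y * (f x * g y)‖ ≤
      K * (√(∑ x, ‖f x‖ ^ 2) * √(∑ y, ‖g y‖ ^ 2)))
    {a b : Type*} [Fintype a] [Fintype b] [DecidableEq a] [DecidableEq b] {ψ : a × b → ℂ}
    (hψ : ∑ p, ‖ψ p‖ ^ 2 = 1) {E : X → Matrix a a ℂ} {G : Y → Matrix b b ℂ}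
    (hE : ∀ x, ‖E x‖ ≤ 1) (hG : ∀ y, ‖G y‖ ≤ 1) :
    ‖∑ x, ∑ y, Φ x y * (star ψ ⬝ᵥ ((E x ⊗ₖ G y) *ᵥ ψ))‖ ≤
      K * (√(Fintype.card X) * √(Fintype.card Y)) := by
  -- Moving `E x` to the left side of the inner product separates the inputs: each entry is a
  -- pairing of two vectors of norm at most one.
  set f : X → a × b → ℂ := fun x => star (((E x)ᴴ ⊗ₖ (1 : Matrix b b ℂ)) *ᵥ ψ) with hf
  set g : Y → a × b → ℂ := fun y => ((1 : Matrix a a ℂ) ⊗ₖ G y) *ᵥ ψ with hg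
  have key : ∀ x y, star ψ ⬝ᵥ ((E x ⊗ₖ G y) *ᵥ ψ) = ∑ p, f x p * g y p := by
    intro x y
    change _ = star (((E x)ᴴ ⊗ₖ (1 : Matrix b b ℂ)) *ᵥ ψ) ⬝ᵥ (((1 : Matrix a a ℂ) ⊗ₖ G y) *ᵥ ψ)
    rw [Matrix.star_mulVec, ← Matrix.dotProduct_mulVec, Matrix.mulVec_mulVec,
      Matrix.conjTranspose_kronecker, ← Matrix.mul_kronecker_mul]
    simp
  have hf1 : ∀ x, ∑ p, ‖f x p‖ ^ 2 ≤ 1 := by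
    intro x
    rw [← hψ]
    simp only [hf, Pi.star_apply, norm_star]
    exact Matrix.sum_norm_sq_kronecker_one_mulVec_le
      ((Matrix.l2_opNorm_conjTranspose _).trans_le (hE x)) ψ
  have hg1 : ∀ y, ∑ p, ‖g y p‖ ^ 2 ≤ 1 := by
    intro y
    rw [← hψ]
    exact Matrix.sum_norm_sq_one_kronecker_mulVec_le (hG y) ψ
  have swap : ∑ x, ∑ y, Φ x y * (star ψ ⬝ᵥ ((E x ⊗ₖ G y) *ᵥ ψ)) =
      ∑ p, ∑ x, ∑ y, Φ x y * (f x p * g y p) := by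
    simp_rw [key, Finset.mul_sum]
    rw [Finset.sum_comm' (t' := Finset.univ) (s' := fun _ => Finset.univ) (by simp)]
    rw [Finset.sum_comm]
    refine (Finset.sum_congr rfl fun x _ => Finset.sum_comm).trans ?_
    rw [Finset.sum_comm]
  rw [swap]
  -- The bilinear bound is applied in each coordinate `p`; Cauchy–Schwarz then sums over `p`.
  calc ‖∑ p, ∑ x, ∑ y, Φ x y * (f x p * g y p)‖
      ≤ ∑ p, K * (√(∑ x, ‖f x p‖ ^ 2) * √(∑ y, ‖g y p‖ ^ 2)) :=
        (norm_sum_le _ _).trans (Finset.sum_le_sum fun p _ => hΦ (fun x => f x p) fun y => g y p)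
    _ ≤ K * (√(∑ p, ∑ x, ‖f x p‖ ^ 2) * √(∑ p, ∑ y, ‖g y p‖ ^ 2)) := by
        rw [← Finset.mul_sum]
        gcongr
        exact Real.sum_sqrt_mul_sqrt_le _ (fun _ => by positivity) fun _ => by positivity
    _ ≤ K * (√(Fintype.card X) * √(Fintype.card Y)) := by
        have hX : ∑ p, ∑ x, ‖f x p‖ ^ 2 ≤ Fintype.card X := by
          rw [Finset.sum_comm]
          exact (Finset.sum_le_sum fun x _ => hf1 x).trans (by simp)
        have hY : ∑ p, ∑ y, ‖g y p‖ ^ 2 ≤ Fintype.card Y := by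
          rw [Finset.sum_comm]
          exact (Finset.sum_le_sum fun y _ => hg1 y).trans (by simp)
        exact mul_le_mul_of_nonneg_left (mul_le_mul (Real.sqrt_le_sqrt hX) (Real.sqrt_le_sqrt hY)
          (Real.sqrt_nonneg _) (Real.sqrt_nonneg _)) hK

namespace EntangledProtocol

theorem sum_norm_sq_state {X : Type u} {Y : Type v} (P : EntangledProtocol X Y) :
    ∑ p, ‖P.state p‖ ^ 2 = 1 := by
  have h := P.state_unit
  rw [star_dotProduct_self_eq_sum_norm_sq] at h
  exact_mod_cast h

theorem outputProb_nonneg {X : Type u} {Y : Type v} (P : EntangledProtocol X Y) (x : X) (y : Y)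
    (o : ℤˣ) : 0 ≤ P.outputProb x y o :=
  P.protocol.outputProb_nonneg x y o P.state

theorem outputProb_one_add_outputProb_neg_one {X : Type u} {Y : Type v}
    (P : EntangledProtocol X Y) (x : X) (y : Y) :
    P.outputProb x y 1 + P.outputProb x y (-1) = 1 := by
  have h := P.protocol.outputProb_one_add_outputProb_neg_one x y P.state
  rwa [P.state_unit, Complex.one_re] at h

/-- The correlation of a bilinear form of norm at most `K` with the output probabilities of a
protocol of cost `C` is at most `4 ^ C * K * √(|X| |Y|)`. -/
theorem abs_sum_mul_outputProb_le {X : Type u} {Y : Type v} [Fintype X] [Fintype Y]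
    (P : EntangledProtocol X Y) (o : ℤˣ) {Φ : X → Y → ℝ} {K : ℝ} (hK : 0 ≤ K)
    (hΦ : ∀ (f : X → ℂ) (g : Y → ℂ), ‖∑ x, ∑ y, (Φ x y : ℂ) * (f x * g y)‖ ≤
      K * (√(∑ x, ‖f x‖ ^ 2) * √(∑ y, ‖g y‖ ^ 2))) :
    |∑ x, ∑ y, Φ x y * P.outputProb x y o| ≤
      4 ^ P.cost * (K * (√(Fintype.card X) * √(Fintype.card Y))) := by
  obtain ⟨ι, _, E, G, hι, hE, hG, hP⟩ := P.protocol.exists_product_observables o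
  have h : ∑ x, ∑ y, Φ x y * P.outputProb x y o =
      (∑ j, ∑ x, ∑ y, (Φ x y : ℂ) *
        (star P.state ⬝ᵥ ((E j x ⊗ₖ G j y) *ᵥ P.state))).re := by
    conv_rhs => rw [Finset.sum_comm, Complex.re_sum]
    refine Finset.sum_congr rfl fun x _ => ?_
    conv_rhs => rw [Finset.sum_comm, Complex.re_sum]
    refine Finset.sum_congr rfl fun y _ => ?_
    rw [outputProb, hP, ← Complex.re_ofReal_mul, Finset.mul_sum]
  rw [h]
  refine (Complex.abs_re_le_norm _).trans ((norm_sum_le _ _).trans ?_)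
  refine (Finset.sum_le_card_nsmul Finset.univ _ _ fun j _ =>
    norm_sum_mul_star_kronecker_le hK hΦ P.sum_norm_sq_state (hE j) (hG j)).trans ?_
  rw [Finset.card_univ, hι, nsmul_eq_mul, cost]
  push_cast
  exact le_rfl

/-- Without communication, the output distribution depends on only one of the two inputs. -/
theorem outputProb_of_cost_eq_zero {X : Type u} {Y : Type v} (P : EntangledProtocol X Y)
    (h : P.cost = 0) (o : ℤˣ) :
    (∀ x y y', P.outputProb x y o = P.outputProb x y' o) ∨
      ∀ x x' y, P.outputProb x y o = P.outputProb x' y o := by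
  obtain ⟨a, b, ψ, hψ, P⟩ := P
  cases P with
  | aliceSend a' U hU P => simp [cost, QuantumProtocol.cost] at h
  | bobSend b' V hV P => simp [cost, QuantumProtocol.cost] at h
  | aliceOutput M hM h1 => exact Or.inl fun _ _ _ => rfl
  | bobOutput M hM h1 => exact Or.inr fun _ _ _ => rfl

end EntangledProtocol

end QuantumDecomposition

/-! ### Fourier analysis on the additive group of matrices -/

section MatrixFourier

open Matrix

theorem trace_transpose_mul_comm {α β R : Type*} [Fintype α] [Fintype β] [CommSemiring R]
    (A S : Matrix α β R) : trace (Aᵀ * S) = trace (Sᵀ * A) := by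
  rw [← trace_transpose, transpose_mul, transpose_transpose]

variable {F : Type*} [Field F] [Fintype F]

theorem exists_addChar_apply_ne_one (F : Type*) [Field F] [Finite F] :
    ∃ χ : AddChar F ℂ, ∃ a, χ a ≠ 1 :=
  (AddChar.exists_apply_ne_zero.2 (one_ne_zero (α := F))).imp fun _ h => ⟨1, h⟩

variable {α β : Type*} [Fintype α] [Fintype β] [DecidableEq α] [DecidableEq β]

/-- Orthogonality of the additive characters of a space of matrices. -/
theorem sum_addChar_trace [DecidableEq F] {χ : AddChar F ℂ} (hχ : ∃ a, χ a ≠ 1)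
    (S : Matrix α β F) :
    ∑ A : Matrix α β F, χ (trace (Aᵀ * S)) =
      if S = 0 then (Fintype.card F : ℂ) ^ (Fintype.card α * Fintype.card β) else 0 := by
  split_ifs with h
  · have hcard : Fintype.card (Matrix α β F) =
        Fintype.card F ^ (Fintype.card α * Fintype.card β) := by
      rw [Fintype.card_congr (Matrix.of (m := α) (n := β) (α := F)).symm]
      simp [pow_mul, mul_comm (Fintype.card α)]
    simp [h, hcard]
  · obtain ⟨a, ha⟩ := hχ
    obtain ⟨i, j, hij⟩ : ∃ i j, S i j ≠ 0 := by
      by_contra! h'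
      exact h (Matrix.ext h')
    -- Translation by `B` multiplies the sum by `χ a ≠ 1`, so the sum vanishes.
    set B : Matrix α β F := Matrix.single i j (a / S i j) with hB
    have hBS : trace (Bᵀ * S) = a := by
      rw [hB, transpose_single, trace_single_mul, smul_eq_mul, div_mul_cancel₀ _ hij]
    refine eq_zero_of_mul_eq_self_left ha ?_
    rw [Finset.mul_sum]
    refine Fintype.sum_equiv (Equiv.addLeft B) _ _ fun A => ?_
    rw [Equiv.coe_addLeft, transpose_add, Matrix.add_mul, trace_add, hBS, AddChar.map_add_eq_mul]

/-- Parseval's identity, for an exponential sum with arbitrary frequencies. -/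
theorem sum_norm_sq_sum_addChar_trace [DecidableEq F] {χ : AddChar F ℂ} (hχ : ∃ a, χ a ≠ 1)
    {ι : Type*} (s : Finset ι) (w : ι → ℂ) (M : ι → Matrix α β F) :
    ((∑ A : Matrix α β F, ‖∑ i ∈ s, w i * χ (trace (Aᵀ * M i))‖ ^ 2 : ℝ) : ℂ) =
      (Fintype.card F : ℂ) ^ (Fintype.card α * Fintype.card β) *
        ∑ i ∈ s, ∑ j ∈ s, if M i = M j then w i * (starRingEnd ℂ) (w j) else 0 := by
  have h1 : ∀ A : Matrix α β F, ((‖∑ i ∈ s, w i * χ (trace (Aᵀ * M i))‖ ^ 2 : ℝ) : ℂ) =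
      ∑ i ∈ s, ∑ j ∈ s, w i * (starRingEnd ℂ) (w j) * χ (trace (Aᵀ * (M i - M j))) := by
    intro A
    rw [Complex.ofReal_pow, ← Complex.mul_conj', map_sum, Finset.sum_mul_sum]
    refine Finset.sum_congr rfl fun i _ => Finset.sum_congr rfl fun j _ => ?_
    rw [map_mul, ← AddChar.map_neg_eq_conj, Matrix.mul_sub, trace_sub, sub_eq_add_neg,
      AddChar.map_add_eq_mul]
    ring
  rw [Complex.ofReal_sum]
  simp_rw [h1]
  rw [Finset.sum_comm, Finset.mul_sum]
  refine Finset.sum_congr rfl fun i _ => ?_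
  rw [Finset.sum_comm, Finset.mul_sum]
  refine Finset.sum_congr rfl fun j _ => ?_
  rw [← Finset.mul_sum, sum_addChar_trace hχ]
  simp only [sub_eq_zero]
  split_ifs <;> ring

theorem sum_norm_sq_matrixFourier [DecidableEq F] {χ : AddChar F ℂ} (hχ : ∃ a, χ a ≠ 1)
    (f : Matrix α β F → ℂ) :
    ∑ S : Matrix α β F, ‖∑ A, f A * χ (trace (Sᵀ * A))‖ ^ 2 =
      (Fintype.card F : ℝ) ^ (Fintype.card α * Fintype.card β) * ∑ A, ‖f A‖ ^ 2 := by
  have h := sum_norm_sq_sum_addChar_trace hχ Finset.univ f id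
  simp only [id, Finset.sum_ite_eq, Finset.mem_univ, if_true, Complex.mul_conj'] at h
  exact_mod_cast h

/-- The operator norm of the matrix `φ (A + B)` is bounded by the Fourier transform of `φ`. -/
theorem norm_sum_add_mul_le {χ : AddChar F ℂ} (hχ : ∃ a, χ a ≠ 1) {φ : Matrix α β F → ℂ} {K : ℝ}
    (hφ : ∀ S : Matrix α β F, ‖∑ Z, φ Z * χ (trace (Zᵀ * S))‖ ≤ K) (f g : Matrix α β F → ℂ) :
    ‖∑ A, ∑ B, φ (A + B) * (f A * g B)‖ ≤
      K * (√(∑ A, ‖f A‖ ^ 2) * √(∑ B, ‖g B‖ ^ 2)) := by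
  classical
  set N : ℝ := (Fintype.card F : ℝ) ^ (Fintype.card α * Fintype.card β) with hN
  have hN0 : 0 < N := by positivity
  have hK : 0 ≤ K := (norm_nonneg _).trans (hφ 0)
  set f' : Matrix α β F → ℂ := fun S => ∑ A, f A * χ (trace (Sᵀ * A)) with hf'
  set g' : Matrix α β F → ℂ := fun S => ∑ A, g A * χ (trace (Sᵀ * A)) with hg'
  -- Characters diagonalise the form: after expansion, orthogonality in `S` forces `Z = A + B`.
  have key : (N : ℂ) * ∑ A, ∑ B, φ (A + B) * (f A * g B) =
      ∑ S, (∑ Z, φ Z * χ (trace (Zᵀ * (-S)))) * (f' S * g' S) := by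
    have h1 : ∀ S, (∑ Z, φ Z * χ (trace (Zᵀ * (-S)))) * (f' S * g' S) =
        ∑ A, ∑ B, ∑ Z, φ Z * (f A * g B) * χ (trace (Sᵀ * (A + B - Z))) := by
      intro S
      simp only [hf', hg', Finset.mul_sum, Finset.sum_mul]
      refine Finset.sum_comm.trans (Finset.sum_congr rfl fun A _ => ?_)
      refine Finset.sum_congr rfl fun B _ => ?_
      refine Finset.sum_congr rfl fun Z _ => ?_
      rw [Matrix.mul_sub, Matrix.mul_add, trace_sub, trace_add, sub_eq_add_neg,
        AddChar.map_add_eq_mul, AddChar.map_add_eq_mul, Matrix.mul_neg, trace_neg,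
        trace_transpose_mul_comm Z S]
      ring
    simp_rw [h1]
    conv_rhs => rw [Finset.sum_comm]
    rw [Finset.mul_sum]
    refine Finset.sum_congr rfl fun A _ => ?_
    conv_rhs => rw [Finset.sum_comm]
    rw [Finset.mul_sum]
    refine Finset.sum_congr rfl fun B _ => ?_
    conv_rhs => rw [Finset.sum_comm]
    simp_rw [← Finset.mul_sum, sum_addChar_trace hχ, sub_eq_zero]
    rw [Finset.sum_eq_single (A + B)]
    · rw [if_pos rfl, hN]
      push_cast
      ring
    · intro Z _ hZ
      rw [if_neg hZ.symm, mul_zero]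
    · simp
  have h2 : N * ‖∑ A, ∑ B, φ (A + B) * (f A * g B)‖ ≤
      N * (K * (√(∑ A, ‖f A‖ ^ 2) * √(∑ B, ‖g B‖ ^ 2))) := by
    calc N * ‖∑ A, ∑ B, φ (A + B) * (f A * g B)‖
        = ‖∑ S, (∑ Z, φ Z * χ (trace (Zᵀ * (-S)))) * (f' S * g' S)‖ := by
          rw [← key, norm_mul, Complex.norm_real, Real.norm_of_nonneg hN0.le]
      _ ≤ ∑ S, K * (‖f' S‖ * ‖g' S‖) := by
          refine (norm_sum_le _ _).trans (Finset.sum_le_sum fun S _ => ?_)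
          rw [norm_mul, norm_mul]
          exact mul_le_mul_of_nonneg_right (hφ _) (by positivity)
      _ ≤ K * (√(∑ S, ‖f' S‖ ^ 2) * √(∑ S, ‖g' S‖ ^ 2)) := by
          rw [← Finset.mul_sum]
          exact mul_le_mul_of_nonneg_left (Real.sum_mul_le_sqrt_mul_sqrt _ _ _) hK
      _ = N * (K * (√(∑ A, ‖f A‖ ^ 2) * √(∑ B, ‖g B‖ ^ 2))) := by
          rw [hf', hg', sum_norm_sq_matrixFourier hχ, sum_norm_sq_matrixFourier hχ, ← hN,
            Real.sqrt_mul hN0.le, Real.sqrt_mul hN0.le]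
          linear_combination (K * (√(∑ A, ‖f A‖ ^ 2) * √(∑ B, ‖g B‖ ^ 2))) *
            Real.mul_self_sqrt hN0.le
  exact le_of_mul_le_mul_left h2 hN0

end MatrixFourier

/-! ### Counting and factoring matrices of full rank -/

section FullRank

open Matrix

/-- The `t × n` matrices of rank `t`. -/
noncomputable def fullRankMatrices (F : Type*) [Field F] [Fintype F] (t n : ℕ) :
    Finset (Matrix (Fin t) (Fin n) F) :=
  open Classical in Finset.univ.filter fun P => P.rank = t

theorem mem_fullRankMatrices {F : Type*} [Field F] [Fintype F] {t n : ℕ}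
    {P : Matrix (Fin t) (Fin n) F} : P ∈ fullRankMatrices F t n ↔ P.rank = t := by
  simp [fullRankMatrices]

theorem rank_eq_iff_linearIndependent_row {F : Type*} [Field F] {t n : ℕ}
    {P : Matrix (Fin t) (Fin n) F} : P.rank = t ↔ LinearIndependent F P.row := by
  rw [linearIndependent_iff_card_eq_finrank_span, P.rank_eq_finrank_span_row, Fintype.card_fin,
    Set.finrank, eq_comm]

/-- `∏_{i < t} (q ^ a - q ^ i)`, the number of linearly independent `t`-tuples in a space of
dimension `a`. -/
def gaussianCount (q : ℝ) (a t : ℕ) : ℝ := ∏ i ∈ Finset.range t, (q ^ a - q ^ i)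

theorem gaussianCount_pos {q : ℝ} (hq : 1 < q) {a t : ℕ} (h : t ≤ a) : 0 < gaussianCount q a t :=
  Finset.prod_pos fun _ hi =>
    sub_pos.2 (pow_lt_pow_right₀ hq ((Finset.mem_range.1 hi).trans_le h))

theorem gaussianCount_add (q : ℝ) {k s : ℕ} (t : ℕ) (h : s ≤ k) :
    gaussianCount q k (s + t) = gaussianCount q k s * (q ^ (s * t) * gaussianCount q (k - s) t) := by
  rw [gaussianCount, Finset.prod_range_add, ← gaussianCount]
  congr 1
  rw [gaussianCount, pow_mul]
  have h1 : ∀ i ∈ Finset.range t, q ^ k - q ^ (s + i) = q ^ s * (q ^ (k - s) - q ^ i) := by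
    intro i _
    rw [mul_sub, ← pow_add, ← pow_add, Nat.add_sub_cancel' h]
  rw [Finset.prod_congr rfl h1, Finset.prod_mul_distrib, Finset.prod_const, Finset.card_range]

/-- Multiplied by `q ^ (s * t)`, both sides become `gaussianCount q k (s + t)`. This trades a count
with `t` factors for one with `s` factors, in which `t` enters only through `q ^ (k - t)`. -/
theorem gaussianCount_symm {q : ℝ} (hq : 0 < q) {k s t : ℕ} (hs : s ≤ k) (ht : t ≤ k) :
    gaussianCount q k s * gaussianCount q (k - s) t =
      gaussianCount q k t * gaussianCount q (k - t) s := by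
  have h1 := gaussianCount_add q t hs
  have h2 := gaussianCount_add q s ht
  rw [add_comm t s, h1, mul_comm t s] at h2
  have h3 : q ^ (s * t) ≠ 0 := by positivity
  apply mul_left_cancel₀ h3
  linear_combination h2

theorem card_linearIndependent_eq_gaussianCount {F V : Type*} [Field F] [Fintype F]
    [AddCommGroup V] [Module F V] [Finite V] (t : ℕ) :
    (Nat.card {v : Fin t → V // LinearIndependent F v} : ℝ) =
      gaussianCount (Fintype.card F) (Module.finrank F V) t := by
  by_cases h : t ≤ Module.finrank F V
  · rw [card_linearIndependent h, gaussianCount, Finset.prod_range, Nat.cast_prod]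
    refine Finset.prod_congr rfl fun i _ => ?_
    rw [Nat.cast_sub (Nat.pow_le_pow_right Fintype.card_pos (i.2.le.trans h))]
    push_cast
    rfl
  · have : IsEmpty {v : Fin t → V // LinearIndependent F v} :=
      ⟨fun v => h (by simpa using v.2.fintype_card_le_finrank)⟩
    rw [Nat.card_of_isEmpty, gaussianCount, Nat.cast_zero, eq_comm]
    exact Finset.prod_eq_zero (Finset.mem_range.2 (not_le.1 h)) (sub_self _)

variable {F : Type*} [Field F] [Fintype F]

theorem one_lt_card_real : (1 : ℝ) < Fintype.card F := by
  exact_mod_cast Fintype.one_lt_card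

theorem card_fullRankMatrices (t n : ℕ) :
    ((fullRankMatrices F t n).card : ℝ) = gaussianCount (Fintype.card F) n t := by
  have h := card_linearIndependent_eq_gaussianCount (F := F) (V := Fin n → F) t
  rw [Module.finrank_fin_fun] at h
  rw [← h, ← Nat.card_eq_finsetCard]
  exact congrArg _ (Nat.card_congr (Equiv.subtypeEquivRight fun P =>
    mem_fullRankMatrices.trans rank_eq_iff_linearIndependent_row))

theorem mul_transpose_eq_zero_iff {R : Type*} [CommSemiring R] {α β γ : Type*} [Fintype β]
    {Q : Matrix α β R} {W : Matrix γ β R} :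
    Q * Wᵀ = 0 ↔ ∀ i, Q i ∈ LinearMap.ker W.mulVecLin := by
  simp only [LinearMap.mem_ker, mulVecLin_apply, ← Matrix.ext_iff, funext_iff]
  simp [mul_apply, mulVec, dotProduct, mul_comm]

theorem finrank_ker_mulVecLin {F : Type*} [Field F] {s m : ℕ} (W : Matrix (Fin s) (Fin m) F) :
    Module.finrank F (LinearMap.ker W.mulVecLin) = m - W.rank := by
  have h := LinearMap.finrank_range_add_finrank_ker W.mulVecLin
  rw [Module.finrank_fin_fun] at h
  rw [Matrix.rank]
  omega

/-- The number of full rank matrices annihilated by a given matrix. -/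
theorem card_filter_fullRankMatrices_mul_eq_zero [DecidableEq F] {s m : ℕ} (t : ℕ)
    (W : Matrix (Fin s) (Fin m) F) :
    (((fullRankMatrices F t m).filter fun Q => Q * Wᵀ = (0 : Matrix (Fin t) (Fin s) F)).card : ℝ) =
      gaussianCount (Fintype.card F) (m - W.rank) t := by
  rw [← finrank_ker_mulVecLin, ← card_linearIndependent_eq_gaussianCount,
    ← Nat.card_eq_finsetCard]
  have hli : ∀ v : Fin t → LinearMap.ker W.mulVecLin,
      LinearIndependent F v ↔ LinearIndependent F fun i => (v i : Fin m → F) := fun v =>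
    (LinearMap.linearIndependent_iff (LinearMap.ker W.mulVecLin).subtype
      (Submodule.ker_subtype _)).symm
  refine congrArg _ (Nat.card_congr
    { toFun := fun Q => ⟨fun i => ⟨Q.1 i, mul_transpose_eq_zero_iff.1 (Finset.mem_filter.1 Q.2).2 i⟩,
        (hli _).2 (rank_eq_iff_linearIndependent_row.1
          (mem_fullRankMatrices.1 (Finset.mem_filter.1 Q.2).1))⟩
      invFun := fun v => ⟨Matrix.of fun i => (v.1 i : Fin m → F), Finset.mem_filter.2
        ⟨mem_fullRankMatrices.2 (rank_eq_iff_linearIndependent_row.2 ((hli _).1 v.2)),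
          mul_transpose_eq_zero_iff.2 fun i => (v.1 i).2⟩⟩
      left_inv := fun _ => rfl
      right_inv := fun _ => rfl })

/-- The number of `t × m` matrices annihilated by a given matrix. -/
theorem card_filter_mul_transpose_eq_zero [DecidableEq F] {n m : ℕ} (t : ℕ)
    (S : Matrix (Fin n) (Fin m) F) :
    (Finset.univ.filter fun D : Matrix (Fin t) (Fin m) F => D * Sᵀ = 0).card *
      Fintype.card F ^ (t * S.rank) = Fintype.card F ^ (t * m) := by
  have h : (Finset.univ.filter fun D : Matrix (Fin t) (Fin m) F => D * Sᵀ = 0).card =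
      Nat.card (Fin t → LinearMap.ker S.mulVecLin) := by
    rw [← Nat.card_eq_finsetCard]
    exact Nat.card_congr
      { toFun := fun Q i => ⟨Q.1 i, mul_transpose_eq_zero_iff.1 (Finset.mem_filter.1 Q.2).2 i⟩
        invFun := fun v => ⟨Matrix.of fun i => (v i : Fin m → F), Finset.mem_filter.2
          ⟨Finset.mem_univ _, mul_transpose_eq_zero_iff.2 fun i => (v i).2⟩⟩
        left_inv := fun _ => rfl
        right_inv := fun _ => rfl }
  rw [h, Nat.card_fun, Module.natCard_eq_pow_finrank (K := F), finrank_ker_mulVecLin,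
    Nat.card_eq_fintype_card, Nat.card_eq_fintype_card, Fintype.card_fin, ← pow_mul, ← pow_add]
  congr 1
  rw [mul_comm _ t, ← mul_add, Nat.sub_add_cancel S.rank_le_width]

/-- The proportion of full rank matrices is `∏ (1 - q ^ (i - n))` over `i < t`. The telescoping
bound is vacuous at `t = n`, so the last factor is split off: it is at least 1/2, and so is the
product of the others. -/
theorem quarter_mul_pow_le_card_fullRankMatrices {t n : ℕ} (h : t ≤ n) :
    (Fintype.card F : ℝ) ^ (n * t) ≤ 4 * (fullRankMatrices F t n).card := by
  rw [card_fullRankMatrices]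
  set q : ℝ := (Fintype.card F : ℝ) with hqd
  have hq : 2 ≤ q := by
    rw [hqd]
    exact_mod_cast Fintype.one_lt_card (α := F)
  have hdouble : ∀ u < n, 2 * q ^ u ≤ q ^ n := fun u hu =>
    calc 2 * q ^ u ≤ q ^ (u + 1) := by rw [pow_succ']; gcongr
      _ ≤ q ^ n := pow_le_pow_right₀ (by linarith) hu
  -- That is, `∏ (1 - q ^ (i - n)) ≥ 1 - q ^ (u - n)` over `i < u`; the induction rests on `(1 - x)
  -- ^ 2 ≥ 1 - q * x` for `q ≥ 2`.
  have key : ∀ u ≤ n, q ^ (n * u) * (q ^ n - q ^ u) ≤ gaussianCount q n u * q ^ n := by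
    intro u
    induction u with
    | zero => intro _; simp [gaussianCount]
    | succ u ih =>
      intro hu
      have h1 := hdouble u hu
      have h0 : 0 < q ^ u := by positivity
      have h2 : 2 * q ^ u ≤ q ^ (u + 1) := by rw [pow_succ']; gcongr
      rw [gaussianCount, Finset.prod_range_succ, ← gaussianCount]
      calc q ^ (n * (u + 1)) * (q ^ n - q ^ (u + 1))
          ≤ (q ^ (n * u) * (q ^ n - q ^ u)) * (q ^ n - q ^ u) := by
            rw [Nat.mul_succ, pow_add, mul_assoc, mul_assoc]
            refine mul_le_mul_of_nonneg_left ?_ (by positivity)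
            nlinarith
        _ ≤ (gaussianCount q n u * q ^ n) * (q ^ n - q ^ u) :=
            mul_le_mul_of_nonneg_right (ih (by omega)) (by linarith)
        _ = _ := by ring
  have hn : 0 < q ^ n := by positivity
  have half : ∀ u < n, q ^ (n * u) ≤ 2 * gaussianCount q n u := by
    intro u hu
    have h1 := hdouble u hu
    have h2 := key u hu.le
    have h3 : 0 < q ^ (n * u) := by positivity
    refine le_of_mul_le_mul_right (?_ : _ * q ^ n ≤ _ * q ^ n) hn
    nlinarith
  rcases t with _ | t
  · simp [gaussianCount]
  · have h1 := hdouble t h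
    have h2 := half t h
    have h3 : 0 < gaussianCount q n t := gaussianCount_pos (by linarith) (by omega)
    rw [gaussianCount, Finset.prod_range_succ, ← gaussianCount, Nat.mul_succ, pow_add]
    nlinarith

/-- Both matrices are injective maps, and the isomorphism between their ranges extends to an
automorphism of the whole space. -/
theorem exists_isUnit_mul_eq {F : Type*} [Field F] {n s : ℕ} {U V : Matrix (Fin n) (Fin s) F}
    (hU : U.rank = s) (hV : V.rank = s) : ∃ G : Matrix (Fin n) (Fin n) F, IsUnit G ∧ V = G * U := by
  have hinj : ∀ U : Matrix (Fin n) (Fin s) F, U.rank = s → Function.Injective U.mulVecLin := by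
    intro U hU
    rw [← LinearMap.ker_eq_bot, ← Submodule.finrank_eq_zero]
    have h := LinearMap.finrank_range_add_finrank_ker U.mulVecLin
    rw [Module.finrank_fin_fun] at h
    rw [Matrix.rank] at hU
    omega
  obtain ⟨g, hg⟩ := Submodule.exists_linearEquiv_restrict_eq
    ((LinearEquiv.ofInjective _ (hinj U hU)).symm.trans (LinearEquiv.ofInjective _ (hinj V hV)))
  refine ⟨LinearMap.toMatrix' g.toLinearMap, ?_, ?_⟩
  · exact LinearMap.isUnit_toMatrix'_iff.2 ((Module.End.isUnit_iff _).2 g.bijective)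
  · apply Matrix.ext_of_mulVec_single
    intro i
    rw [← mulVec_mulVec, ← toLin'_apply (LinearMap.toMatrix' _), toLin'_toMatrix']
    have h := hg (LinearEquiv.ofInjective U.mulVecLin (hinj U hU) (Pi.single i 1))
    rw [LinearEquiv.trans_apply, LinearEquiv.symm_apply_apply] at h
    exact h

/-- The columns of `U` form a basis of the column space of `S`, and `W` holds the coordinates of the
columns of `S`. -/
theorem exists_rank_factorization {F : Type*} [Field F] {n m : ℕ} (S : Matrix (Fin n) (Fin m) F) :
    ∃ (U : Matrix (Fin n) (Fin S.rank) F) (W : Matrix (Fin S.rank) (Fin m) F),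
      U.rank = S.rank ∧ W.rank = S.rank ∧ S = U * W := by
  suffices h : ∃ (U : Matrix (Fin n) (Fin S.rank) F) (W : Matrix (Fin S.rank) (Fin m) F),
      S = U * W by
    obtain ⟨U, W, h⟩ := h
    refine ⟨U, W, le_antisymm (U.rank_le_width) ?_, le_antisymm (W.rank_le_height) ?_, h⟩
    · conv_lhs => rw [h]
      exact rank_mul_le_left _ _
    · conv_lhs => rw [h]
      exact rank_mul_le_right _ _
  let b := Module.finBasis F (LinearMap.range S.mulVecLin)
  refine ⟨Matrix.of fun i k => (b k : Fin n → F) i,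
    Matrix.of fun k j => b.repr ⟨S *ᵥ Pi.single j 1, _, rfl⟩ k, ?_⟩
  ext i j
  have h := congrArg (fun v : LinearMap.range S.mulVecLin => (v : Fin n → F) i)
    (b.sum_repr ⟨S *ᵥ Pi.single j 1, _, rfl⟩)
  simp only [AddSubmonoidClass.coe_finsetSum, Submodule.coe_smul, Finset.sum_apply,
    Pi.smul_apply, smul_eq_mul] at h
  have hS : S i j = (S *ᵥ Pi.single j 1) i := by simp
  rw [mul_apply]
  refine hS.trans (h.symm.trans (Finset.sum_congr rfl fun k _ => ?_))
  rw [mul_comm]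
  rfl

theorem exists_mul_transpose_eq_one {F : Type*} [Field F] {t n : ℕ}
    {P : Matrix (Fin t) (Fin n) F} (hP : P.rank = t) :
    ∃ L : Matrix (Fin t) (Fin n) F, L * Pᵀ = 1 := by
  have hsurj : Function.Surjective P.mulVecLin := by
    rw [← LinearMap.range_eq_top]
    apply Submodule.eq_top_of_finrank_eq
    rw [Module.finrank_fin_fun]
    exact hP
  obtain ⟨B, hB⟩ := mulVec_surjective_iff_exists_right_inverse.1 hsurj
  exact ⟨Bᵀ, by rw [← transpose_mul, hB, transpose_one]⟩

theorem rank_transpose_mul_eq {F : Type*} [Field F] {t n m : ℕ} {P : Matrix (Fin t) (Fin n) F}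
    {Q : Matrix (Fin t) (Fin m) F} (hP : P.rank = t) (hQ : Q.rank = t) : (Pᵀ * Q).rank = t := by
  obtain ⟨L, hL⟩ := exists_mul_transpose_eq_one hP
  refine le_antisymm ((rank_mul_le_right _ _).trans hQ.le) ?_
  calc t = (L * (Pᵀ * Q)).rank := by rw [← Matrix.mul_assoc, hL, Matrix.one_mul, hQ]
    _ ≤ _ := rank_mul_le_right _ _

end FullRank

/-! ### Fourier coefficients of random matrices of given rank -/

section RankKernel

open Matrix

variable {F : Type*} [Field F] [Fintype F]

/-- The average of `h` over the products `Pᵀ * Q`, for random `t × n` and `t × m` matrices `P` and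
`Q` of rank `t`. -/
noncomputable def rankAverage (F : Type*) [Field F] [Fintype F] (n m t : ℕ)
    (h : Matrix (Fin n) (Fin m) F → ℂ) : ℂ :=
  (∑ P ∈ fullRankMatrices F t n, ∑ Q ∈ fullRankMatrices F t m, h (Pᵀ * Q)) /
    ((fullRankMatrices F t n).card * (fullRankMatrices F t m).card)

theorem card_fullRankMatrices_pos {t n : ℕ} (h : t ≤ n) :
    0 < ((fullRankMatrices F t n).card : ℝ) := by
  rw [card_fullRankMatrices]
  exact gaussianCount_pos one_lt_card_real h

/-- Cauchy–Schwarz in `P`, extended to all `P`, and Parseval reduce the sum to counting pairs with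
`Q * Sᵀ = Q' * Sᵀ`. Their differences annihilate `S`, which leaves a fraction `q ^ (-t * rank S)` of
all matrices. -/
theorem norm_sum_sum_addChar_sq_mul_le {χ : AddChar F ℂ} (hχ : ∃ a, χ a ≠ 1) {n m : ℕ} (t : ℕ)
    (S : Matrix (Fin n) (Fin m) F) :
    ‖∑ P ∈ fullRankMatrices F t n, ∑ Q ∈ fullRankMatrices F t m, χ (trace ((Pᵀ * Q)ᵀ * S))‖ ^ 2 *
      (Fintype.card F : ℝ) ^ (t * S.rank) ≤
      (fullRankMatrices F t n).card * (fullRankMatrices F t m).card *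
        (Fintype.card F : ℝ) ^ (t * n + t * m) := by
  classical
  set q : ℝ := (Fintype.card F : ℝ) with hq
  set D := (Finset.univ.filter fun D : Matrix (Fin t) (Fin m) F => D * Sᵀ = 0).card with hD
  have hDq : (D : ℝ) * q ^ (t * S.rank) = q ^ (t * m) := by
    rw [hq, hD]
    exact_mod_cast card_filter_mul_transpose_eq_zero t S
  have htr : ∀ (P : Matrix (Fin t) (Fin n) F) (Q : Matrix (Fin t) (Fin m) F),
      trace ((Pᵀ * Q)ᵀ * S) = trace (Pᵀ * (Q * Sᵀ)) := by
    intro P Q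
    rw [trace_transpose_mul_comm, trace_mul_comm, Matrix.mul_assoc]
  have hpars := sum_norm_sq_sum_addChar_trace hχ (fullRankMatrices F t m) (fun _ => 1)
    fun Q : Matrix (Fin t) (Fin m) F => Q * Sᵀ
  simp only [one_mul, map_one, Finset.sum_boole, Fintype.card_fin] at hpars
  have hcount : ∀ Q ∈ fullRankMatrices F t m,
      ((fullRankMatrices F t m).filter fun Q' => Q * Sᵀ = Q' * Sᵀ).card ≤ D := by
    intro Q _
    refine Finset.card_le_card_of_injOn (fun Q' => Q' - Q) ?_ (sub_left_injective.injOn)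
    intro Q' hQ'
    have h := (Finset.mem_filter.1 hQ').2
    simp [Matrix.sub_mul, h]
  have hsum : ∑ P : Matrix (Fin t) (Fin n) F,
      ‖∑ Q ∈ fullRankMatrices F t m, χ (trace (Pᵀ * (Q * Sᵀ)))‖ ^ 2 ≤
        q ^ (t * n) * ((fullRankMatrices F t m).card * D) := by
    have h1 : (∑ P : Matrix (Fin t) (Fin n) F,
        ‖∑ Q ∈ fullRankMatrices F t m, χ (trace (Pᵀ * (Q * Sᵀ)))‖ ^ 2 : ℝ) =
        q ^ (t * n) * ∑ Q ∈ fullRankMatrices F t m,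
          (((fullRankMatrices F t m).filter fun Q' => Q * Sᵀ = Q' * Sᵀ).card : ℝ) := by
      rw [hq]
      exact_mod_cast hpars
    rw [h1]
    refine mul_le_mul_of_nonneg_left ?_ (by positivity)
    rw [← nsmul_eq_mul]
    exact Finset.sum_le_card_nsmul _ _ _ fun Q hQ => by exact_mod_cast hcount Q hQ
  simp_rw [htr]
  calc ‖∑ P ∈ fullRankMatrices F t n, ∑ Q ∈ fullRankMatrices F t m,
          χ (trace (Pᵀ * (Q * Sᵀ)))‖ ^ 2 * q ^ (t * S.rank)
      ≤ ((fullRankMatrices F t n).card * ∑ P ∈ fullRankMatrices F t n,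
          ‖∑ Q ∈ fullRankMatrices F t m, χ (trace (Pᵀ * (Q * Sᵀ)))‖ ^ 2) * q ^ (t * S.rank) := by
        refine mul_le_mul_of_nonneg_right ?_ (by positivity)
        exact (pow_le_pow_left₀ (norm_nonneg _) (norm_sum_le _ _) 2).trans
          sq_sum_le_card_mul_sum_sq
    _ ≤ ((fullRankMatrices F t n).card * (q ^ (t * n) * ((fullRankMatrices F t m).card * D))) *
          q ^ (t * S.rank) := by
        refine mul_le_mul_of_nonneg_right (mul_le_mul_of_nonneg_left ?_ (by positivity))
          (by positivity)
        exact (Finset.sum_le_univ_sum_of_nonneg fun P => by positivity).trans hsum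
    _ = _ := by
        rw [pow_add, ← hDq]
        ring

/-- The Fourier coefficients of the random matrix `Pᵀ * Q` decay exponentially in the product of
the ranks. -/
theorem norm_rankAverage_addChar_le {χ : AddChar F ℂ} (hχ : ∃ a, χ a ≠ 1) {n m t : ℕ}
    (hn : t ≤ n) (hm : t ≤ m) (S : Matrix (Fin n) (Fin m) F) :
    ‖rankAverage F n m t fun Z => χ (trace (Zᵀ * S))‖ ≤
      4 * (Fintype.card F : ℝ) ^ (-((t : ℝ) * S.rank / 2)) := by
  have hq : (0 : ℝ) < Fintype.card F := one_pos.trans one_lt_card_real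
  have hX := card_fullRankMatrices_pos (F := F) hn
  have hY := card_fullRankMatrices_pos (F := F) hm
  have h1 := norm_sum_sum_addChar_sq_mul_le hχ t S
  have hX4 := quarter_mul_pow_le_card_fullRankMatrices (F := F) hn
  have hY4 := quarter_mul_pow_le_card_fullRankMatrices (F := F) hm
  rw [rankAverage, norm_div, norm_mul, Complex.norm_natCast, Complex.norm_natCast]
  set T := ‖∑ P ∈ fullRankMatrices F t n, ∑ Q ∈ fullRankMatrices F t m,
    χ (trace ((Pᵀ * Q)ᵀ * S))‖
  set x : ℝ := ((fullRankMatrices F t n).card : ℝ)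
  set y : ℝ := ((fullRankMatrices F t m).card : ℝ)
  set q : ℝ := (Fintype.card F : ℝ)
  have hpow : (q ^ (-((t : ℝ) * S.rank / 2))) ^ 2 * q ^ (t * S.rank) = 1 := by
    rw [← Real.rpow_natCast q, ← Real.rpow_natCast, ← Real.rpow_mul hq.le, ← Real.rpow_add hq]
    convert Real.rpow_zero q using 2
    push_cast
    ring
  refine (pow_le_pow_iff_left₀ (by positivity) (by positivity) two_ne_zero).1 ?_
  refine le_of_mul_le_mul_right (?_ : _ * q ^ (t * S.rank) ≤ _ * q ^ (t * S.rank)) (by positivity)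
  rw [mul_pow, mul_assoc, hpow, mul_one, div_pow, div_mul_eq_mul_div, div_le_iff₀ (by positivity)]
  calc T ^ 2 * q ^ (t * S.rank) ≤ x * y * q ^ (t * n + t * m) := h1
    _ = x * y * (q ^ (n * t) * q ^ (m * t)) := by rw [pow_add, mul_comm n, mul_comm m]
    -- Full rank matrices make up at least a quarter on each side; the square root of `4 * 4` is the
    -- constant 4.
    _ ≤ x * y * ((4 * x) * (4 * y)) := by gcongr
    _ = 4 ^ 2 * (x * y) ^ 2 := by ring

/-- The substitution `P ↦ P * G` permutes the full rank matrices and moves `G` onto `S`. -/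
theorem rankAverage_addChar_mul_left (χ : AddChar F ℂ) {n m : ℕ} (t : ℕ)
    {G : Matrix (Fin n) (Fin n) F} (hG : IsUnit G) (S : Matrix (Fin n) (Fin m) F) :
    (rankAverage F n m t fun Z => χ (trace (Zᵀ * (G * S)))) =
      rankAverage F n m t fun Z => χ (trace (Zᵀ * S)) := by
  rw [rankAverage, rankAverage]
  congr 1
  have hdet : IsUnit G.det := (isUnit_iff_isUnit_det _).1 hG
  refine Finset.sum_bij (fun P _ => P * G) ?_ ?_ ?_ ?_
  · intro P hP
    rw [mem_fullRankMatrices] at hP ⊢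
    rwa [rank_mul_eq_left_of_isUnit_det _ _ hdet]
  · intro P _ P' _ h
    simpa [Matrix.mul_assoc, mul_nonsing_inv _ hdet] using congrArg (· * G⁻¹) h
  · intro P hP
    refine ⟨P * G⁻¹, ?_, ?_⟩
    · rw [mem_fullRankMatrices] at hP ⊢
      rwa [rank_mul_eq_left_of_isUnit_det _ _ (isUnit_nonsing_inv_det _ hdet)]
    · rw [Matrix.mul_assoc, nonsing_inv_mul _ hdet, Matrix.mul_one]
  · intro P _
    refine Finset.sum_congr rfl fun Q _ => ?_
    congr 2
    simp only [transpose_mul, transpose_transpose, Matrix.mul_assoc]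

/-- Orthogonality in `U` keeps only the `Q` with `Q * Wᵀ = 0`, since `Pᵀ` is left invertible. By
`gaussianCount_symm` their proportion is `gaussianCount q (m - t) s / gaussianCount q m s`, a
polynomial of degree `s` in `q⁻ᵗ`. -/
theorem sum_rankAverage_addChar_mul {χ : AddChar F ℂ} (hχ : ∃ a, χ a ≠ 1) {n m t s : ℕ}
    (hn : t ≤ n) (hm : t ≤ m) {W : Matrix (Fin s) (Fin m) F} (hW : W.rank = s) :
    ∑ U : Matrix (Fin n) (Fin s) F, rankAverage F n m t (fun Z => χ (trace (Zᵀ * (U * W)))) =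
      (((Fintype.card F : ℝ) ^ (n * s) * (∏ i ∈ Finset.range s,
        ((Fintype.card F : ℝ) ^ m * ((Fintype.card F : ℝ) ^ t)⁻¹ - (Fintype.card F : ℝ) ^ i)) /
          gaussianCount (Fintype.card F) m s : ℝ) : ℂ) := by
  classical
  have hs : s ≤ m := hW ▸ W.rank_le_width
  set q : ℝ := (Fintype.card F : ℝ) with hq
  have hq1 : 1 < q := one_lt_card_real
  have hX := card_fullRankMatrices_pos (F := F) hn
  have hY := card_fullRankMatrices_pos (F := F) hm
  have h1 : ∀ P ∈ fullRankMatrices F t n, ∀ Q : Matrix (Fin t) (Fin m) F,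
      ∑ U : Matrix (Fin n) (Fin s) F, χ (trace ((Pᵀ * Q)ᵀ * (U * W))) =
        if Q * Wᵀ = 0 then (q : ℂ) ^ (n * s) else 0 := by
    intro P hP Q
    obtain ⟨L, hL⟩ := exists_mul_transpose_eq_one (mem_fullRankMatrices.1 hP)
    have h2 : ∀ U : Matrix (Fin n) (Fin s) F,
        trace ((Pᵀ * Q)ᵀ * (U * W)) = trace (Uᵀ * (Pᵀ * (Q * Wᵀ))) := by
      intro U
      rw [trace_transpose_mul_comm, transpose_mul, Matrix.mul_assoc, trace_mul_comm]
      simp only [Matrix.mul_assoc]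
    simp_rw [h2]
    rw [sum_addChar_trace hχ, Fintype.card_fin, Fintype.card_fin]
    have h3 : Pᵀ * (Q * Wᵀ) = 0 ↔ Q * Wᵀ = 0 := by
      refine ⟨fun h => ?_, fun h => by rw [h, Matrix.mul_zero]⟩
      rw [← Matrix.one_mul (Q * Wᵀ), ← hL, Matrix.mul_assoc, h, Matrix.mul_zero]
    simp only [h3, hq, Complex.ofReal_natCast]
  have h4 : ∑ U : Matrix (Fin n) (Fin s) F,
      rankAverage F n m t (fun Z => χ (trace (Zᵀ * (U * W)))) =
      (((fullRankMatrices F t n).card * (q ^ (n * s) * gaussianCount q (m - s) t) /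
        ((fullRankMatrices F t n).card * (fullRankMatrices F t m).card) : ℝ) : ℂ) := by
    simp_rw [rankAverage]
    rw [← Finset.sum_div, Finset.sum_comm]
    have h5 : ∀ P ∈ fullRankMatrices F t n, ∑ U : Matrix (Fin n) (Fin s) F,
        ∑ Q ∈ fullRankMatrices F t m, χ (trace ((Pᵀ * Q)ᵀ * (U * W))) =
          ((q ^ (n * s) * gaussianCount q (m - s) t : ℝ) : ℂ) := by
      intro P hP
      rw [Finset.sum_comm, Finset.sum_congr rfl fun Q _ => h1 P hP Q, ← Finset.sum_filter,
        Finset.sum_const, nsmul_eq_mul]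
      have h6 := card_filter_fullRankMatrices_mul_eq_zero t W
      rw [hW] at h6
      rw [← h6]
      push_cast
      ring
    rw [Finset.sum_congr rfl h5, Finset.sum_const, nsmul_eq_mul]
    push_cast
    rfl
  have h7 : gaussianCount q (m - t) s =
      ∏ i ∈ Finset.range s, (q ^ m * (q ^ t)⁻¹ - q ^ i) := by
    have hq0 : q ≠ 0 := by positivity
    rw [gaussianCount, pow_sub₀ q hq0 hm]
  rw [h4, ← h7, card_fullRankMatrices (F := F) t m, ← hq]
  congr 1
  have h8 := gaussianCount_symm (zero_lt_one.trans hq1) hs hm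
  have h9 := gaussianCount_pos hq1 hs
  have h10 := gaussianCount_pos hq1 hm
  field_simp
  linear_combination h8

/-- If the weights `c t` annihilate all polynomials of degree at most `d` in `q⁻ᵗ`, then the
corresponding combination of the laws of `Pᵀ * Q` has no Fourier coefficients of rank at most
`d`. -/
theorem sum_mul_rankAverage_addChar_eq_zero {χ : AddChar F ℂ} (hχ : ∃ a, χ a ≠ 1) {n m d : ℕ}
    {T : Finset ℕ} (hT : ∀ t ∈ T, t ≤ min n m) {c : ℕ → ℝ}
    (hc : ∀ p : Polynomial ℝ, p.natDegree ≤ d →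
      ∑ t ∈ T, c t * p.eval ((Fintype.card F : ℝ) ^ t)⁻¹ = 0) (S : Matrix (Fin n) (Fin m) F)
    (hS : S.rank ≤ d) :
    ∑ t ∈ T, (c t : ℂ) * rankAverage F n m t (fun Z => χ (trace (Zᵀ * S))) = 0 := by
  classical
  induction hr : S.rank using Nat.strong_induction_on generalizing S with
  | _ s ih =>
    obtain ⟨U₀, W, hU₀, hW, hUW⟩ := exists_rank_factorization S
    set q : ℝ := (Fintype.card F : ℝ) with hq
    -- With `W` fixed, the sum over all left factors is a polynomial in `q⁻ᵗ` of degree at most `d`,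
    -- hence killed by the weights.
    have h1 : ∑ U : Matrix (Fin n) (Fin S.rank) F,
        ∑ t ∈ T, (c t : ℂ) * rankAverage F n m t (fun Z => χ (trace (Zᵀ * (U * W)))) = 0 := by
      rw [Finset.sum_comm]
      have h2 : ∀ t ∈ T, ∑ U : Matrix (Fin n) (Fin S.rank) F,
          (c t : ℂ) * rankAverage F n m t (fun Z => χ (trace (Zᵀ * (U * W)))) =
          ((c t * (Polynomial.C (q ^ (n * S.rank) / gaussianCount q m S.rank) *
            ∏ i ∈ Finset.range S.rank,
              (Polynomial.C (q ^ m) * Polynomial.X - Polynomial.C (q ^ i))).eval (q ^ t)⁻¹ : ℝ) :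
                ℂ) := by
        intro t ht
        have htm := le_min_iff.1 (hT t ht)
        rw [← Finset.mul_sum, sum_rankAverage_addChar_mul hχ htm.1 htm.2 hW, Complex.ofReal_mul]
        congr 2
        rw [Polynomial.eval_mul, Polynomial.eval_C, Polynomial.eval_prod]
        simp only [Polynomial.eval_sub, Polynomial.eval_mul, Polynomial.eval_C, Polynomial.eval_X]
        ring
      rw [Finset.sum_congr rfl h2, ← Complex.ofReal_sum, hc, Complex.ofReal_zero]
      refine (Polynomial.natDegree_C_mul_le _ _).trans ((Polynomial.natDegree_prod_le _ _).trans ?_)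
      refine (Finset.sum_le_card_nsmul _ _ 1 fun i _ => ?_).trans (by simpa using hS)
      refine (Polynomial.natDegree_sub_C).trans_le ?_
      exact (Polynomial.natDegree_C_mul_le _ _).trans Polynomial.natDegree_X_le
    -- Left factors of smaller rank contribute zero by induction; those of full rank form one orbit
    -- and each contributes the coefficient at `S`. So a positive multiple of that coefficient
    -- vanishes.
    have h3 : ∀ U : Matrix (Fin n) (Fin S.rank) F,
        ∑ t ∈ T, (c t : ℂ) * rankAverage F n m t (fun Z => χ (trace (Zᵀ * (U * W)))) =
        if U.rank = S.rank then
          ∑ t ∈ T, (c t : ℂ) * rankAverage F n m t (fun Z => χ (trace (Zᵀ * S))) else 0 := by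
      intro U
      split_ifs with hU
      · obtain ⟨G, hG, rfl⟩ := exists_isUnit_mul_eq hU₀ hU
        refine Finset.sum_congr rfl fun t _ => ?_
        rw [Matrix.mul_assoc, rankAverage_addChar_mul_left χ t hG, ← hUW]
      · have hlt : (U * W).rank < s :=
          hr ▸ (rank_mul_le_left U W).trans_lt (lt_of_le_of_ne U.rank_le_width hU)
        exact ih _ hlt _ (hlt.le.trans (hr ▸ hS)) rfl
    rw [Finset.sum_congr rfl fun U _ => h3 U, ← Finset.sum_filter, Finset.sum_const,
      smul_eq_zero] at h1
    exact h1.resolve_left (Finset.card_ne_zero_of_mem (Finset.mem_filter.2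
      ⟨Finset.mem_univ U₀, hU₀⟩))

end RankKernel

/-! ### The witness: annihilating weights and the rank laws -/

section RankWitness

open Matrix

/-- Weights on `{l, …, l + d - 1} ∪ {r, R}` that annihilate all polynomials of degree at most `d`
in `q⁻ᵗ`, and are concentrated on `r` and `R`. -/
theorem exists_annihilating_weights {q : ℝ} (hq : 2 ≤ q) {l d r R : ℕ} (h : l + d ≤ r)
    (hR : r < R) :
    ∃ c : ℕ → ℝ, c r = -1 ∧ 0 ≤ c R ∧ c R ≤ 1 ∧
      (∀ t ∈ Finset.Ico l (l + d), |c t| ≤ 2 ^ d * (q ^ t / q ^ r)) ∧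
      ∀ p : Polynomial ℝ, p.natDegree ≤ d →
        ∑ t ∈ insert R (insert r (Finset.Ico l (l + d))), c t * p.eval (q ^ t)⁻¹ = 0 := by
  set M := Finset.Ico l (l + d) with hM
  set T := insert R (insert r M) with hT
  set x : ℕ → ℝ := fun t => (q ^ t)⁻¹ with hx
  have hq0 : 0 < q := by linarith
  have hx0 : ∀ t, 0 < x t := fun t => by simp only [hx]; positivity
  have hxlt : ∀ {s t}, s < t → 2 * x t ≤ x s := by
    intro s t hst
    simp only [hx]
    rw [← div_eq_mul_inv, div_le_iff₀ (by positivity), ← div_eq_inv_mul, le_div_iff₀ (by positivity)]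
    calc 2 * q ^ s ≤ q ^ (s + 1) := by rw [pow_succ']; gcongr
      _ ≤ q ^ t := pow_le_pow_right₀ (by linarith) hst
  have hanti : StrictAnti x := by
    intro s t hst
    linarith [hxlt hst, hx0 t]
  have hrM : r ∉ M := by simp only [hM, Finset.mem_Ico]; omega
  have hRM : R ∉ insert r M := by simp only [hM, Finset.mem_insert, Finset.mem_Ico]; omega
  have hRM' : R ∉ M := fun h => hRM (Finset.mem_insert_of_mem h)
  have hMlt : ∀ j ∈ M, j < r := by
    intro j hj
    rw [hM, Finset.mem_Ico] at hj
    omega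
  -- The weights `1 / w t` form the divided difference at the `d + 2` nodes `x t`, which reads off
  -- the coefficient of degree `d + 1`. They are rescaled by `-w r` to have value `-1` at `r`.
  set w : ℕ → ℝ := fun t => ∏ j ∈ T.erase t, (x t - x j) with hw
  have hw0 : ∀ t, w t ≠ 0 := fun t => Finset.prod_ne_zero_iff.2 fun j hj =>
    sub_ne_zero.2 (hanti.injective.ne (Finset.ne_of_mem_erase hj).symm)
  have hwr : w r = (x r - x R) * ∏ j ∈ M, (x r - x j) := by
    have h1 : T.erase r = insert R M := by
      rw [hT, Finset.erase_insert_of_ne hR.ne', Finset.erase_insert hrM]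
    simp only [hw]
    rw [h1, Finset.prod_insert hRM']
  have hwR : w R = (x R - x r) * ∏ j ∈ M, (x R - x j) := by
    simp only [hw]
    rw [hT, Finset.erase_insert hRM, Finset.prod_insert hrM]
  have hwM : ∀ t ∈ M, w t = (x t - x R) * ((x t - x r) * ∏ j ∈ M.erase t, (x t - x j)) := by
    intro t ht
    have htr := (hMlt t ht)
    simp only [hw]
    rw [hT, Finset.erase_insert_of_ne (by omega), Finset.erase_insert_of_ne (by omega),
      Finset.prod_insert, Finset.prod_insert]
    · exact fun h => hrM (Finset.mem_of_mem_erase h)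
    · intro h
      rcases Finset.mem_insert.1 h with h | h
      · omega
      · exact hRM' (Finset.mem_of_mem_erase h)
  have hxr : 0 < x r - x R := sub_pos.2 (hanti hR)
  have hratR : -(w r / w R) = ∏ j ∈ M, (x j - x r) / (x j - x R) := by
    have h1 : ∀ j ∈ M, (x j - x r) / (x j - x R) = (x r - x j) / (x R - x j) := by
      intro j _
      rw [← neg_sub, ← neg_sub (x R), neg_div_neg_eq]
    rw [Finset.prod_congr rfl h1, Finset.prod_div_distrib, hwr, hwR, mul_div_mul_comm,
      ← neg_sub (x r) (x R), div_neg, div_self hxr.ne']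
    ring
  refine ⟨fun t => -(w r / w t), by simp [hw0 r], ?_, ?_, ?_, ?_⟩
  · beta_reduce
    rw [hratR]
    exact Finset.prod_nonneg fun j hj => div_nonneg (sub_nonneg.2 (hanti (hMlt j hj)).le)
      (sub_nonneg.2 (hanti ((hMlt j hj).trans hR)).le)
  · beta_reduce
    rw [hratR]
    refine Finset.prod_le_one (fun j hj => div_nonneg (sub_nonneg.2 (hanti (hMlt j hj)).le)
      (sub_nonneg.2 (hanti ((hMlt j hj).trans hR)).le)) fun j hj => ?_
    rw [div_le_one (sub_pos.2 (hanti ((hMlt j hj).trans hR)))]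
    linarith
  · intro t ht
    have htr := hMlt t ht
    have h1 : w r / w t = (x r - x R) / (x t - x R) * ((x r - x t) / (x t - x r)) *
        ∏ j ∈ M.erase t, (x r - x j) / (x t - x j) := by
      rw [hwr, hwM t ht, ← Finset.mul_prod_erase M _ ht, mul_div_mul_comm, mul_div_mul_comm,
        Finset.prod_div_distrib, mul_assoc]
    have h2 : (x r - x t) / (x t - x r) = -1 := by
      rw [← neg_sub, neg_div, div_self (sub_pos.2 (hanti htr)).ne']
    -- The node `R` supplies the decay: subtracting `x R` from both terms of `x r / x t ≤ 1` can
    -- only decrease the ratio.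
    have h3 : |(x r - x R) / (x t - x R)| ≤ q ^ t / q ^ r := by
      have h4 : 0 < x t - x R := sub_pos.2 (hanti (htr.trans hR))
      have h5 : q ^ t / q ^ r = x r / x t := by
        simp only [hx]
        field_simp
      rw [abs_of_pos (div_pos hxr h4), h5, div_le_div_iff₀ h4 (hx0 t)]
      nlinarith [hanti htr, hx0 R]
    -- Consecutive nodes at least halve, so `|x r - x j| ≤ x j ≤ 2 * |x t - x j|` and each factor is
    -- at most 2.
    have h6 : |∏ j ∈ M.erase t, (x r - x j) / (x t - x j)| ≤ 2 ^ d := by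
      rw [Finset.abs_prod]
      have h7 : (M.erase t).card ≤ d := (Finset.card_le_card (M.erase_subset t)).trans (by simp [hM])
      refine (Finset.prod_le_prod (g := fun _ => (2 : ℝ)) (fun j _ => abs_nonneg _)
        fun j hj => ?_).trans ((Finset.prod_const 2).trans_le (pow_le_pow_right₀ one_le_two h7))
      have hjM := Finset.mem_of_mem_erase hj
      have hjt := Finset.ne_of_mem_erase hj
      have h8 : |x r - x j| ≤ x j := by
        rw [abs_sub_comm, abs_of_pos (sub_pos.2 (hanti (hMlt j hjM)))]
        linarith [hx0 r]
      have h9 : x j ≤ 2 * |x t - x j| := by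
        rcases lt_or_gt_of_ne hjt with hlt | hlt
        · rw [abs_sub_comm, abs_of_pos (sub_pos.2 (hanti hlt))]
          linarith [hxlt hlt]
        · rw [abs_of_pos (sub_pos.2 (hanti hlt))]
          linarith [hxlt hlt, hx0 j]
      rw [abs_div, div_le_iff₀ (abs_pos.2 (sub_ne_zero.2 (hanti.injective.ne hjt.symm)))]
      exact h8.trans h9
    beta_reduce
    rw [h1, h2, mul_neg_one, abs_neg, abs_mul, abs_neg, mul_comm]
    exact mul_le_mul h6 h3 (abs_nonneg _) (by positivity)
  · intro p hp
    have hcard : T.card = d + 2 := by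
      rw [hT, Finset.card_insert_of_notMem hRM, Finset.card_insert_of_notMem hrM]
      simp [hM]
    have h1 := Lagrange.coeff_eq_sum (s := T) (v := x) hanti.injective.injOn (P := p) (by
      rw [hcard]
      refine (Polynomial.degree_le_natDegree).trans_lt ?_
      exact_mod_cast (by omega : p.natDegree < d + 2))
    rw [hcard, Polynomial.coeff_eq_zero_of_natDegree_lt (by omega)] at h1
    calc ∑ t ∈ T, -(w r / w t) * p.eval (q ^ t)⁻¹
        = -(w r * ∑ t ∈ T, p.eval (x t) / w t) := by
          rw [Finset.mul_sum, ← Finset.sum_neg_distrib]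
          exact Finset.sum_congr rfl fun t _ => by simp only [hx]; ring
      _ = 0 := by rw [← h1]; ring

variable {F : Type*} [Field F] [Fintype F]

/-- The law of `Pᵀ * Q`, for random `t × n` and `t × m` matrices `P` and `Q` of rank `t`. -/
noncomputable def rankLaw (F : Type*) [Field F] [Fintype F] (n m t : ℕ)
    (Z : Matrix (Fin n) (Fin m) F) : ℝ :=
  open Classical in
  (((fullRankMatrices F t n ×ˢ fullRankMatrices F t m).filter fun p => p.1ᵀ * p.2 = Z).card : ℝ) /
    ((fullRankMatrices F t n).card * (fullRankMatrices F t m).card)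

theorem rankLaw_nonneg (n m t : ℕ) (Z : Matrix (Fin n) (Fin m) F) : 0 ≤ rankLaw F n m t Z := by
  rw [rankLaw]
  positivity

theorem sum_rankLaw_mul (n m t : ℕ) (h : Matrix (Fin n) (Fin m) F → ℂ) :
    ∑ Z, (rankLaw F n m t Z : ℂ) * h Z = rankAverage F n m t h := by
  classical
  rw [rankAverage, ← Finset.sum_product', ← Finset.sum_fiberwise_of_maps_to
    (t := Finset.univ) (g := fun p : Matrix (Fin t) (Fin n) F × Matrix (Fin t) (Fin m) F =>
      p.1ᵀ * p.2) (fun _ _ => Finset.mem_univ _), Finset.sum_div]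
  refine Finset.sum_congr rfl fun Z _ => ?_
  have h1 : ∀ p ∈ (fullRankMatrices F t n ×ˢ fullRankMatrices F t m).filter
      (fun p : Matrix (Fin t) (Fin n) F × Matrix (Fin t) (Fin m) F => p.1ᵀ * p.2 = Z),
      h (p.1ᵀ * p.2) = h Z := fun p hp => by
    rw [(Finset.mem_filter.1 hp).2]
  rw [Finset.sum_congr rfl h1, Finset.sum_const, nsmul_eq_mul, rankLaw]
  push_cast
  rw [div_mul_eq_mul_div]

theorem sum_rankLaw {n m t : ℕ} (hn : t ≤ n) (hm : t ≤ m) :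
    ∑ Z : Matrix (Fin n) (Fin m) F, rankLaw F n m t Z = 1 := by
  have h := sum_rankLaw_mul (F := F) n m t fun _ => 1
  have hX := (card_fullRankMatrices_pos (F := F) hn).ne'
  have hY := (card_fullRankMatrices_pos (F := F) hm).ne'
  rw [rankAverage] at h
  simp only [mul_one, Finset.sum_const, nsmul_eq_mul] at h
  rw [div_self (mul_ne_zero (by exact_mod_cast hX) (by exact_mod_cast hY))] at h
  exact_mod_cast h

theorem rank_eq_of_rankLaw_ne_zero {n m t : ℕ} {Z : Matrix (Fin n) (Fin m) F}
    (h : rankLaw F n m t Z ≠ 0) : Z.rank = t := by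
  classical
  by_contra hZ
  refine h ?_
  rw [rankLaw, Finset.card_eq_zero.2, Nat.cast_zero, zero_div]
  refine Finset.filter_eq_empty_iff.2 fun p hp hpZ => hZ ?_
  rw [Finset.mem_product, mem_fullRankMatrices, mem_fullRankMatrices] at hp
  rw [← hpZ, rank_transpose_mul_eq hp.1 hp.2]

theorem exists_rank_eq (F : Type*) [Field F] [Fintype F] {n m t : ℕ} (hn : t ≤ n) (hm : t ≤ m) :
    ∃ Z : Matrix (Fin n) (Fin m) F, Z.rank = t := by
  obtain ⟨Z, -, hZ⟩ := Finset.exists_ne_zero_of_sum_ne_zero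
    ((sum_rankLaw (F := F) hn hm).trans_ne one_ne_zero)
  exact ⟨Z, rank_eq_of_rankLaw_ne_zero hZ⟩

theorem sum_rankLaw_mul_le {n m t : ℕ} (hn : t ≤ n) (hm : t ≤ m)
    {H : Matrix (Fin n) (Fin m) F → ℝ} {a : ℝ} (hH : ∀ Z, Z.rank = t → H Z ≤ a) :
    ∑ Z, rankLaw F n m t Z * H Z ≤ a := by
  calc ∑ Z, rankLaw F n m t Z * H Z ≤ ∑ Z, rankLaw F n m t Z * a := by
        refine Finset.sum_le_sum fun Z _ => ?_
        by_cases h : rankLaw F n m t Z = 0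
        · simp [h]
        · exact mul_le_mul_of_nonneg_left (hH Z (rank_eq_of_rankLaw_ne_zero h))
            (rankLaw_nonneg n m t Z)
    _ = a := by rw [← Finset.sum_mul, sum_rankLaw hn hm, one_mul]

theorem le_sum_rankLaw_mul {n m t : ℕ} (hn : t ≤ n) (hm : t ≤ m)
    {H : Matrix (Fin n) (Fin m) F → ℝ} {a : ℝ} (hH : ∀ Z, Z.rank = t → a ≤ H Z) :
    a ≤ ∑ Z, rankLaw F n m t Z * H Z := by
  have h := sum_rankLaw_mul_le hn hm (H := fun Z => -H Z) (a := -a)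
    fun Z hZ => neg_le_neg (hH Z hZ)
  simp only [mul_neg, Finset.sum_neg_distrib] at h
  linarith

/-- Fourier bound for a combination of the rank laws with annihilating weights. -/
theorem norm_sum_sum_mul_rankLaw_mul_addChar_le {χ : AddChar F ℂ} (hχ : ∃ a, χ a ≠ 1) {n m d : ℕ}
    {T : Finset ℕ} (hT : ∀ t ∈ T, t ≤ min n m) {c : ℕ → ℝ}
    (hc : ∀ p : Polynomial ℝ, p.natDegree ≤ d →
      ∑ t ∈ T, c t * p.eval ((Fintype.card F : ℝ) ^ t)⁻¹ = 0) {E : ℝ}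
    (hE : ∀ t ∈ T, E ≤ (t : ℝ) * (d + 1) / 2) (S : Matrix (Fin n) (Fin m) F) :
    ‖∑ Z, ((∑ t ∈ T, c t * rankLaw F n m t Z : ℝ) : ℂ) * χ (trace (Zᵀ * S))‖ ≤
      4 * (Fintype.card F : ℝ) ^ (-E) * ∑ t ∈ T, |c t| := by
  have hq : (1 : ℝ) < Fintype.card F := one_lt_card_real
  have h1 : ∑ Z, ((∑ t ∈ T, c t * rankLaw F n m t Z : ℝ) : ℂ) * χ (trace (Zᵀ * S)) =
      ∑ t ∈ T, (c t : ℂ) * rankAverage F n m t (fun Z => χ (trace (Zᵀ * S))) := by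
    simp_rw [← sum_rankLaw_mul, Complex.ofReal_sum, Complex.ofReal_mul, Finset.sum_mul,
      Finset.mul_sum, mul_assoc]
    exact Finset.sum_comm
  rw [h1]
  -- Low ranks are annihilated by the weights; high ranks are small by the decay in `t * S.rank`.
  by_cases hS : S.rank ≤ d
  · rw [sum_mul_rankAverage_addChar_eq_zero hχ hT hc S hS, norm_zero]
    positivity
  · rw [Finset.mul_sum]
    refine (norm_sum_le _ _).trans (Finset.sum_le_sum fun t ht => ?_)
    have htm := le_min_iff.1 (hT t ht)
    rw [norm_mul, Complex.norm_real, Real.norm_eq_abs, mul_comm]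
    refine mul_le_mul_of_nonneg_right ?_ (abs_nonneg _)
    refine (norm_rankAverage_addChar_le hχ htm.1 htm.2 S).trans ?_
    refine mul_le_mul_of_nonneg_left (Real.rpow_le_rpow_of_exponent_le hq.le ?_) (by norm_num)
    have h2 : ((d : ℝ) + 1) ≤ S.rank := by exact_mod_cast not_le.1 hS
    have h3 := hE t ht
    have h4 : (t : ℝ) * (d + 1) ≤ t * S.rank := mul_le_mul_of_nonneg_left h2 (Nat.cast_nonneg t)
    linarith

theorem rankProblem_of_rank_eq_left {F : Type*} [Field F] {n m r R : ℕ}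
    {A B : Matrix (Fin n) (Fin m) F}
    (h : (A + B).rank = r) : rankProblem F n m r R A B = some (-1) := by
  rw [rankProblem, if_pos h]

theorem rankProblem_of_rank_eq_right {F : Type*} [Field F] {n m r R : ℕ} (hR : r < R)
    {A B : Matrix (Fin n) (Fin m) F}
    (h : (A + B).rank = R) : rankProblem F n m r R A B = some 1 := by
  rw [rankProblem, if_neg (by omega), if_pos h]

/-- This provides the summand 1 of the bound. Without communication one input is ignored; let that
input decide the rank while the other is zero. -/
theorem one_le_cost_of_computes_rankProblem {n m r R : ℕ} (hRn : R ≤ min n m) (hrR : r < R)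
    {γ : ℝ} (hγ : 0 < γ)
    {P : EntangledProtocol (Matrix (Fin n) (Fin m) F) (Matrix (Fin n) (Fin m) F)}
    (hP : P.Computes (1 / 2 - γ / 2) (rankProblem F n m r R)) : 1 ≤ P.cost := by
  have hR := le_min_iff.1 hRn
  obtain ⟨Z, hZ⟩ := exists_rank_eq F (hrR.le.trans hR.1) (hrR.le.trans hR.2)
  obtain ⟨Z', hZ'⟩ := exists_rank_eq F hR.1 hR.2
  by_contra hcost
  rcases P.outputProb_of_cost_eq_zero (by omega) (-1) with h | h
  · have h1 := hP 0 Z (-1) (rankProblem_of_rank_eq_left (by rwa [zero_add]))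
    have h2 := hP 0 Z' 1 (rankProblem_of_rank_eq_right hrR (by rwa [zero_add]))
    have h3 := P.outputProb_one_add_outputProb_neg_one 0 Z'
    rw [h 0 Z Z'] at h1
    linarith
  · have h1 := hP Z 0 (-1) (rankProblem_of_rank_eq_left (by rwa [add_zero]))
    have h2 := hP Z' 0 1 (rankProblem_of_rank_eq_right hrR (by rwa [add_zero]))
    have h3 := P.outputProb_one_add_outputProb_neg_one Z' 0
    rw [h Z Z' 0] at h1
    linarith

/-- A protocol with advantage `γ` has cost at least `log₄ (γ / 4K)`, where `K` bounds the Fourier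
transform of a combination of the rank laws that is concentrated on the ranks `r` and `R`. -/
theorem advantage_le_of_computes_rankProblem {n m r R : ℕ} (hRn : R ≤ min n m) (hrR : r < R)
    {γ : ℝ} {P : EntangledProtocol (Matrix (Fin n) (Fin m) F) (Matrix (Fin n) (Fin m) F)}
    (hP : P.Computes (1 / 2 - γ / 2) (rankProblem F n m r R))
    {M : Finset ℕ} (hM : ∀ t ∈ M, t < r) {c : ℕ → ℝ} (hcr : c r = -1) (hcR : 0 ≤ c R)
    (hγ : 0 ≤ γ) (hcM : ∑ t ∈ M, |c t| ≤ γ / 2) {χ : AddChar F ℂ} (hχ : ∃ a, χ a ≠ 1) {K : ℝ}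
    (hK : ∀ S : Matrix (Fin n) (Fin m) F,
      ‖∑ Z, ((∑ t ∈ insert R (insert r M), c t * rankLaw F n m t Z : ℝ) : ℂ) *
        χ (trace (Zᵀ * S))‖ ≤ K) :
    γ ≤ 4 * 4 ^ P.cost * K := by
  classical
  set T := insert R (insert r M) with hTdef
  have hR := le_min_iff.1 hRn
  have hrM : r ∉ M := fun h => (hM r h).false
  have hRM : R ∉ insert r M := by
    intro h
    rcases Finset.mem_insert.1 h with h | h
    · omega
    · exact (hM R h).not_gt hrR
  set φ : Matrix (Fin n) (Fin m) F → ℝ := fun Z => ∑ t ∈ T, c t * rankLaw F n m t Z with hφ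
  set N : ℝ := (Fintype.card (Matrix (Fin n) (Fin m) F) : ℝ) with hN
  have hN0 : 0 < N := by
    rw [hN]
    exact_mod_cast Fintype.card_pos
  have hK0 : 0 ≤ K := (norm_nonneg _).trans (hK 0)
  have hupper : ∀ o, |∑ A, ∑ B, φ (A + B) * P.outputProb A B o| ≤ 4 ^ P.cost * (K * N) := by
    intro o
    have h := P.abs_sum_mul_outputProb_le o (Φ := fun A B => φ (A + B)) hK0
      fun f g => norm_sum_add_mul_le hχ (φ := fun Z => (φ Z : ℂ)) hK f g
    rwa [← hN, Real.mul_self_sqrt hN0.le] at h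
  set e : Matrix (Fin n) (Fin m) F → Matrix (Fin n) (Fin m) F → ℝ := fun A B =>
    P.outputProb A B 1 - P.outputProb A B (-1) with he
  have he1 : ∀ A B, |e A B| ≤ 1 := by
    intro A B
    have h1 := P.outputProb_one_add_outputProb_neg_one A B
    have h2 := P.outputProb_nonneg A B 1
    have h3 := P.outputProb_nonneg A B (-1)
    simp only [he]
    rw [abs_le]
    constructor <;> linarith
  -- The total bias over the `N` input pairs with `A + B = Z`.
  set H : Matrix (Fin n) (Fin m) F → ℝ := fun Z => ∑ A, e A (Z - A) with hH
  have hsum : ∑ A, ∑ B, φ (A + B) * e A B = ∑ t ∈ T, c t * ∑ Z, rankLaw F n m t Z * H Z := by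
    have h1 : ∀ A, ∑ B, φ (A + B) * e A B = ∑ Z, φ Z * e A (Z - A) := fun A =>
      Fintype.sum_equiv (Equiv.addLeft A) _ _ fun B => by simp
    simp_rw [h1]
    rw [Finset.sum_comm]
    simp_rw [← Finset.mul_sum]
    change ∑ Z, φ Z * H Z = _
    simp_rw [hφ, Finset.sum_mul, Finset.mul_sum]
    rw [Finset.sum_comm]
    exact Finset.sum_congr rfl fun t _ => Finset.sum_congr rfl fun Z _ => mul_assoc _ _ _
  have hcardsum : ∀ a : ℝ, ∑ _A : Matrix (Fin n) (Fin m) F, a = N * a := fun a => by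
    rw [Finset.sum_const, Finset.card_univ, nsmul_eq_mul]
  have hHR : ∀ Z, Z.rank = R → N * γ ≤ H Z := by
    intro Z hZ
    rw [← hcardsum]
    refine Finset.sum_le_sum fun A _ => ?_
    have h1 := hP A (Z - A) 1 (rankProblem_of_rank_eq_right hrR (by rwa [add_sub_cancel]))
    have h2 := P.outputProb_one_add_outputProb_neg_one A (Z - A)
    simp only [he]
    linarith
  have hHr : ∀ Z, Z.rank = r → H Z ≤ N * (-γ) := by
    intro Z hZ
    rw [← hcardsum]
    refine Finset.sum_le_sum fun A _ => ?_
    have h1 := hP A (Z - A) (-1) (rankProblem_of_rank_eq_left (by rwa [add_sub_cancel]))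
    have h2 := P.outputProb_one_add_outputProb_neg_one A (Z - A)
    simp only [he]
    linarith
  have hHN : ∀ Z, |H Z| ≤ N := by
    intro Z
    refine (Finset.abs_sum_le_sum_abs _ _).trans ?_
    exact (Finset.sum_le_sum fun A _ => he1 A (Z - A)).trans (by rw [hcardsum, mul_one])
  -- Rank `r` has weight `-1` and bias at most `-N * γ`, so it gains `N * γ`; rank `R` cannot hurt,
  -- and the remaining ranks lose at most half of the gain.
  have hlower : N * (γ / 2) ≤ ∑ A, ∑ B, φ (A + B) * e A B := by
    rw [hsum, hTdef, Finset.sum_insert hRM, Finset.sum_insert hrM, hcr]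
    have h1 : N * γ ≤ ∑ Z, rankLaw F n m R Z * H Z := le_sum_rankLaw_mul hR.1 hR.2 hHR
    have h2 : ∑ Z, rankLaw F n m r Z * H Z ≤ N * (-γ) :=
      sum_rankLaw_mul_le (hrR.le.trans hR.1) (hrR.le.trans hR.2) hHr
    have h3 : ∀ t ∈ M, -(|c t| * N) ≤ c t * ∑ Z, rankLaw F n m t Z * H Z := by
      intro t ht
      have htr := hM t ht
      have h4 : |∑ Z, rankLaw F n m t Z * H Z| ≤ N := abs_le.2
        ⟨le_sum_rankLaw_mul (by omega) (by omega) fun Z _ => (abs_le.1 (hHN Z)).1,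
          sum_rankLaw_mul_le (by omega) (by omega) fun Z _ => (abs_le.1 (hHN Z)).2⟩
      refine (neg_le_neg ?_).trans (neg_abs_le _)
      rw [abs_mul]
      exact mul_le_mul_of_nonneg_left h4 (abs_nonneg _)
    have h5 := Finset.sum_le_sum h3
    rw [Finset.sum_neg_distrib, ← Finset.sum_mul] at h5
    have h6 := mul_le_mul_of_nonneg_right hcM hN0.le
    have h7 : 0 ≤ c R * ∑ Z, rankLaw F n m R Z * H Z :=
      mul_nonneg hcR ((mul_nonneg hN0.le hγ).trans h1)
    linarith
  -- The bias is a difference of two output probabilities; this factor 2 and the loss of half of `γ`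
  -- make up the 4 in the conclusion.
  have hsplit : ∑ A, ∑ B, φ (A + B) * e A B =
      ∑ A, ∑ B, φ (A + B) * P.outputProb A B 1 - ∑ A, ∑ B, φ (A + B) * P.outputProb A B (-1) := by
    simp only [he, mul_sub, Finset.sum_sub_distrib]
  have h1 := (abs_le.1 (hupper 1)).2
  have h2 := (abs_le.1 (hupper (-1))).1
  refine le_of_mul_le_mul_left (?_ : N * _ ≤ N * _) hN0
  rw [hsplit] at hlower
  linarith

end RankWitness

/-! ### Choice of parameters and the final bound -/

section RankLowerBound

variable {F : Type u} [Field F] [Fintype F]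

/-- The total weight off the ranks `r` and `R` is below the advantage of the protocol. -/
theorem sum_weights_le {q : ℝ} (hq : 2 ≤ q) {r : ℕ} {c : ℕ → ℝ}
    (hc : ∀ t ∈ Finset.Ico ((r + 1) / 2) ((r + 1) / 2 + r / 40),
      |c t| ≤ 2 ^ (r / 40) * (q ^ t / q ^ r)) :
    ∑ t ∈ Finset.Ico ((r + 1) / 2) ((r + 1) / 2 + r / 40), |c t| ≤
      1 / (2 * q ^ ((r : ℝ) / 3)) / 2 := by
  have hq0 : 0 < q := by linarith
  set d := r / 40 with hd
  set l := (r + 1) / 2 with hl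
  rcases Nat.eq_zero_or_pos d with h0 | hd1
  · rw [h0]
    simp only [add_zero, Finset.Ico_self, Finset.sum_empty]
    positivity
  have hr40 : (40 : ℝ) ≤ r := by exact_mod_cast (by omega : 40 ≤ r)
  have hd40 : (d : ℝ) * 40 ≤ r := by exact_mod_cast (by omega : d * 40 ≤ r)
  have hl2 : (l : ℝ) * 2 ≤ r + 1 := by exact_mod_cast (by omega : l * 2 ≤ r + 1)
  have hterm : ∀ t ∈ Finset.Ico l (l + d), |c t| ≤ q ^ ((2 * d : ℝ) + l - 1 - r) := by
    intro t ht
    have htl : (t : ℝ) ≤ l + d - 1 := by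
      have : t + 1 ≤ l + d := (Finset.mem_Ico.1 ht).2
      have h' : (t : ℝ) + 1 ≤ l + d := by exact_mod_cast this
      linarith
    refine (hc t ht).trans ?_
    calc (2 : ℝ) ^ d * (q ^ t / q ^ r) ≤ q ^ d * (q ^ t / q ^ r) := by gcongr
      _ = q ^ ((d : ℝ) + t - r) := by
        rw [Real.rpow_sub hq0, Real.rpow_add hq0, Real.rpow_natCast, Real.rpow_natCast,
          Real.rpow_natCast]
        ring
      _ ≤ _ := Real.rpow_le_rpow_of_exponent_le (by linarith) (by linarith)
  refine (Finset.sum_le_card_nsmul _ _ _ hterm).trans ?_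
  rw [Nat.card_Ico, add_tsub_cancel_left, nsmul_eq_mul]
  have hdq : (d : ℝ) ≤ q ^ (d : ℝ) := by
    rw [Real.rpow_natCast]
    calc (d : ℝ) ≤ 2 ^ d := by exact_mod_cast Nat.lt_two_pow_self.le
      _ ≤ q ^ d := by gcongr
  have h4 : q ^ (-2 : ℝ) ≤ 1 / 4 := by
    rw [Real.rpow_neg hq0.le, Real.rpow_two, one_div]
    exact inv_anti₀ (by norm_num) (by nlinarith)
  calc (d : ℝ) * q ^ ((2 * d : ℝ) + l - 1 - r)
      ≤ q ^ (d : ℝ) * q ^ ((2 * d : ℝ) + l - 1 - r) := by gcongr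
    _ = q ^ ((3 * d : ℝ) + l - 1 - r) := by
        rw [← Real.rpow_add hq0]
        ring_nf
    -- As `d ≤ r / 40` and `l ≤ (r + 1) / 2`, the exponent is at most `-0.425 r - 1/2`; for `r ≥ 40`
    -- this is below `-r/3 - 2`.
    _ ≤ q ^ (-2 + -((r : ℝ) / 3)) :=
        Real.rpow_le_rpow_of_exponent_le (by linarith) (by linarith)
    _ ≤ 1 / 4 * q ^ (-((r : ℝ) / 3)) := by
        rw [Real.rpow_add hq0]
        gcongr
    _ = _ := by
        rw [Real.rpow_neg hq0.le]
        field_simp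
        norm_num

/-- The term `r / 3` will cancel the advantage, and `r² / 480 ≤ r (d + 1) / 12` is what remains. The
tight case is `t ≥ r / 2`, where `r (d + 1) / 4` must cover both: it does since the interval is
nonempty only if `d ≥ 1`. -/
theorem exponent_le {r R t : ℕ} (hR : r < R)
    (ht : t ∈ insert R (insert r (Finset.Ico ((r + 1) / 2) ((r + 1) / 2 + r / 40)))) :
    (r : ℝ) / 3 + (r : ℝ) ^ 2 / 480 ≤ (t : ℝ) * ((r / 40 : ℕ) + 1) / 2 := by
  set d := r / 40 with hd
  have hr0 : (0 : ℝ) ≤ r := Nat.cast_nonneg r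
  have hd0 : (0 : ℝ) ≤ d := Nat.cast_nonneg d
  have hd1 : (r : ℝ) ≤ 40 * (d + 1) := by exact_mod_cast (by omega : r ≤ 40 * (d + 1))
  have hlarge : r ≤ t → (r : ℝ) / 3 + (r : ℝ) ^ 2 / 480 ≤ (t : ℝ) * (d + 1) / 2 := by
    intro h
    have h' : (r : ℝ) ≤ t := by exact_mod_cast h
    nlinarith [mul_le_mul_of_nonneg_right h' (by linarith : (0 : ℝ) ≤ d + 1),
      mul_le_mul_of_nonneg_left hd1 hr0, mul_nonneg hr0 hd0]
  rw [Finset.mem_insert, Finset.mem_insert] at ht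
  rcases ht with rfl | rfl | ht
  · exact hlarge hR.le
  · exact hlarge le_rfl
  · rw [Finset.mem_Ico] at ht
    have hd1' : (1 : ℝ) ≤ d := by exact_mod_cast (by omega : 1 ≤ d)
    have ht' : (r : ℝ) ≤ 2 * t := by exact_mod_cast (by omega : r ≤ 2 * t)
    nlinarith [mul_le_mul_of_nonneg_right ht' (by linarith : (0 : ℝ) ≤ d + 1),
      mul_le_mul_of_nonneg_left hd1 hr0, mul_le_mul_of_nonneg_left hd1' hr0]

theorem rpow_le_four_pow_cost {n m r R : ℕ} (hRn : R ≤ min n m) (hrR : r < R)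
    {P : EntangledProtocol (Matrix (Fin n) (Fin m) F) (Matrix (Fin n) (Fin m) F)}
    (hP : P.Computes (1 / 2 - 1 / (4 * (Fintype.card F : ℝ) ^ ((r : ℝ) / 3)))
      (rankProblem F n m r R)) :
    (Fintype.card F : ℝ) ^ ((r : ℝ) ^ 2 / 480) ≤ 96 * 4 ^ P.cost := by
  obtain ⟨χ, hχ⟩ := exists_addChar_apply_ne_one F
  have hq : (2 : ℝ) ≤ Fintype.card F := by exact_mod_cast Fintype.one_lt_card (α := F)
  have hq0 : (0 : ℝ) < Fintype.card F := by linarith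
  obtain ⟨c, hcr, hcR0, hcR1, hcM, hc⟩ := exists_annihilating_weights hq
    (l := (r + 1) / 2) (d := r / 40) (r := r) (R := R) (by omega) hrR
  have hsum := sum_weights_le hq hcM
  set q : ℝ := (Fintype.card F : ℝ) with hqd
  set M := Finset.Ico ((r + 1) / 2) ((r + 1) / 2 + r / 40) with hM
  set γ : ℝ := 1 / (2 * q ^ ((r : ℝ) / 3)) with hγ
  have hγ0 : 0 < γ := by positivity
  have hMr : ∀ t ∈ M, t < r := by
    intro t ht
    rw [hM, Finset.mem_Ico] at ht
    omega
  have hP' : P.Computes (1 / 2 - γ / 2) (rankProblem F n m r R) := by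
    convert hP using 2
    rw [hγ]
    field_simp
    norm_num
  have hT : ∀ t ∈ insert R (insert r M), t ≤ min n m := by
    intro t ht
    rw [Finset.mem_insert, Finset.mem_insert] at ht
    rcases ht with rfl | rfl | ht
    · exact hRn
    · omega
    · have := hMr t ht
      omega
  have h1 := advantage_le_of_computes_rankProblem hRn hrR hP' hMr hcr hcR0 hγ0.le hsum hχ
    (norm_sum_sum_mul_rankLaw_mul_addChar_le hχ hT hc fun t ht => exponent_le hrR ht)
  have hγ1 : γ ≤ 1 := by
    rw [hγ, div_le_one (by positivity)]
    have : 1 ≤ q ^ ((r : ℝ) / 3) := Real.one_le_rpow (by linarith) (by positivity)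
    linarith
  have hc3 : ∑ t ∈ insert R (insert r M), |c t| ≤ 3 := by
    rw [Finset.sum_insert, Finset.sum_insert, hcr, abs_of_nonneg hcR0]
    · norm_num
      linarith
    · exact fun h => (hMr r h).false
    · intro h
      rcases Finset.mem_insert.1 h with h | h
      · omega
      · exact (hMr R h).not_gt hrR
  -- The factor `q ^ (r/3)` in `γ` cancels against the Fourier bound, leaving `96 = 2 * 4 * 4 * 3`.
  have h2 : γ ≤ 4 * 4 ^ P.cost * (4 * q ^ (-((r : ℝ) / 3 + (r : ℝ) ^ 2 / 480)) * 3) :=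
    h1.trans (by gcongr)
  rw [neg_add, Real.rpow_add hq0, Real.rpow_neg hq0.le, Real.rpow_neg hq0.le, hγ,
    div_le_iff₀ (by positivity)] at h2
  have h3 : 0 < q ^ ((r : ℝ) / 3) := by positivity
  have h4 : 0 < q ^ ((r : ℝ) ^ 2 / 480) := by positivity
  field_simp at h2
  linarith

theorem logb_le_cost {n m r R : ℕ} (hRn : R ≤ min n m) (hrR : r < R)
    {P : EntangledProtocol (Matrix (Fin n) (Fin m) F) (Matrix (Fin n) (Fin m) F)}
    (hP : P.Computes (1 / 2 - 1 / (4 * (Fintype.card F : ℝ) ^ ((r : ℝ) / 3)))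
      (rankProblem F n m r R)) :
    1 / 8640 * (1 + (r : ℝ) ^ 2 * Real.logb 2 (Fintype.card F : ℝ)) ≤ P.cost := by
  have hq : (0 : ℝ) < Fintype.card F := one_pos.trans one_lt_card_real
  have h1 := rpow_le_four_pow_cost hRn hrR hP
  have hcost : (1 : ℝ) ≤ P.cost := by
    have hγ : 0 < 1 / (2 * (Fintype.card F : ℝ) ^ ((r : ℝ) / 3)) := by positivity
    refine Nat.one_le_cast.2 (one_le_cost_of_computes_rankProblem hRn hrR hγ ?_)
    convert hP using 2
    field_simp
    norm_num
  -- From `96 ≤ 2 ^ 7` and cost `C ≥ 1`, `r² log₂ q / 480 ≤ 7 + 2C ≤ 9C`; then `8640 = 2 * 480 * 9`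
  -- leaves room for the summand 1.
  have h2 : (96 : ℝ) * 4 ^ P.cost ≤ 2 ^ (7 + 2 * (P.cost : ℝ)) := by
    rw [Real.rpow_add two_pos, Real.rpow_mul two_pos.le, Real.rpow_natCast]
    norm_num
  have h3 := Real.logb_le_logb_of_le one_lt_two (by positivity) (h1.trans h2)
  rw [Real.logb_rpow_eq_mul_logb_of_pos hq, Real.logb_rpow two_pos (by norm_num)] at h3
  linarith

/-- Costs are integers, so a real lower bound may be rounded up before taking the infimum in `ℕ∞`.
-/
theorem ofReal_le_quantumCC {X : Type u} {Y : Type v} {ε a : ℝ} {f : X → Y → Option ℤˣ}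
    (h : ∀ P : EntangledProtocol X Y, P.Computes ε f → a ≤ P.cost) :
    ENNReal.ofReal a ≤ (quantumCC ε f : ENNReal) := by
  have h1 : (⌈a⌉₊ : ℕ∞) ≤ quantumCC ε f :=
    le_iInf₂ fun P hP => by exact_mod_cast Nat.ceil_le.2 (h P hP)
  calc ENNReal.ofReal a ≤ ENNReal.ofReal (⌈a⌉₊ : ℝ) := ENNReal.ofReal_le_ofReal (Nat.le_ceil a)
    _ = ((⌈a⌉₊ : ℕ∞) : ENNReal) := by simp
    _ ≤ _ := ENat.toENNReal_le.2 h1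

end RankLowerBound

theorem theorem1p1 :
    ∃ c : ℝ, 0 < c ∧
      ∀ (F : Type u) [Field F] [Fintype F] (n m R r : ℕ), R ≤ min n m → r < R →
        ENNReal.ofReal (c * (1 + (r : ℝ) ^ 2 * Real.logb 2 (Fintype.card F : ℝ))) ≤
            (quantumCC (1 / 2 - 1 / (4 * (Fintype.card F : ℝ) ^ ((r : ℝ) / 3)))
              (rankProblem F n m r R) : ENNReal) ∧
        ENNReal.ofReal (c * (1 + (r : ℝ) ^ 2 * Real.logb 2 (Fintype.card F : ℝ))) ≤
            (quantumCC (1 / 4) (rankProblem F n m r R) : ENNReal) := by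
  refine ⟨1 / 8640, by norm_num, fun F _ _ n m R r hRn hrR =>
    ⟨ofReal_le_quantumCC fun P hP => logb_le_cost hRn hrR hP,
      ofReal_le_quantumCC fun P hP => logb_le_cost hRn hrR fun x y o h => ?_⟩⟩
  -- Since `q ^ (r/3) ≥ 1`, the error allowed in the first bound is at least 1/4, so the second
  -- bound is a special case.
  have h1 : 1 ≤ (Fintype.card F : ℝ) ^ ((r : ℝ) / 3) :=
    Real.one_le_rpow one_lt_card_real.le (by positivity)
  have h2 : 1 / (4 * (Fintype.card F : ℝ) ^ ((r : ℝ) / 3)) ≤ 1 / 4 :=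
    one_div_le_one_div_of_le (by norm_num) (by linarith)
  have h3 := hP x y o h
  linarith
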